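/- **Proposition.** Indices start at $0$, matrices are complex, $m\ge 1$ and $n=m^2$. *Classes.* Let $\mathcal M^{(n)}$ be the class of Monarch matrices $\mathbf P\mathbf L\mathbf P^{\top}\mathbf R$, where $\mathbf L,\mathbf R$ are block-diagonal with $m$ blocks of size $m\times m$ and $\mathbf P$ is the permutation matrix of $am+c\mapsto cm+a$ ($0\le a,c<m$). More generally, for $b$ dividing $N$, let $\mathcal M^{(b,N)}$ be the class of $N\times N$ products $\mathbf L\mathbf R$, where $\mathbf L$ consists of $b\times b$ blocks each of which is diagonal, and $\mathbf R$ is block-diagonal with $b\times b$ blocks; then $\mathcal M^{(n)}=\mathcal M^{(m,n)}$. Put $\mathcal M\mathcal M^{*}=\{\mathbf M_1\mathbf M_2^{*}:\mathbf M_1,\mathbf M_2\in\mathcal M\}$ and $(\mathcal M\mathcal M^*)^2=\{\mathbf M_1\mathbf M_2:\mathbf M_1,\mathbf M_2\in\mathcal M\mathcal M^*\}$; without superscripts these are taken with $\mathcal M=\mathcal M^{(n)}$. For $w\in\{1,2\}$ let $(\mathcal M\mathcal M^{*})^{w}_{2}$ be the class of all leading $n\times n$ submatrices of members of $(\mathcal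 M\mathcal M^{*})^{w}$ formed with $\mathcal M=\mathcal M^{(m,2n)}$ (so the $n$-dimensional input is padded with $n$ zeros and the first $n$ outputs are kept). *Transforms.* Let $\mathbf F=(e^{-2\pi i jk/n})_{j,k}$ be the DFT matrix; let the DCT and the DST be the orthonormal type-II matrices $$\mathbf C_{k,q}=w_k\cos\frac{\pi(2q+1)k}{2n},\qquad \mathbf S_{k,q}=w'_k\sin\frac{\pi(2q+1)(k+1)}{2n}\qquad(0\le k,q<n),$$ with $w_0=w'_{n-1}=\sqrt{1/n}$ and all other $w_k,w'_k$ equal to $\sqrt{2/n}$; and, for $n$ a power of two, let $\mathbf H$ be the Walsh–Hadamard matrix, $\mathbf H_{i,j}=(-1)^{s(i,j)}$ with $s(i,j)$ the number of binary positions at which both $i$ and $j$ have digit $1$. 1. The class $\mathcal M\mathcal M^*$ contains every circular convolution $x\mapsto h\circledast x$ ($h\in\mathbb C^n$), the Hadamard matrix $\mathbf H$ (if $m$ is a power of two), and every AFDF matrix $\mathbf A\mathbf F\mathbf D\mathbf F^{-1}$ with $\mathbf A,\mathbf D$ diagonal. Every $n\times n$ Toeplitz matrix belongs to $(\mathcal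 M\mathcal M^*)^1_2$. 2. The class $(\mathcal M\mathcal M^*)^2$ contains $\mathbf F$ and, if $m$ is a power of two, every matrix of the $(HD)^3$ class, $\mathbf H\mathbf D_1\mathbf H\mathbf D_2\mathbf H\mathbf D_3$ with $\mathbf D_i$ diagonal, and every Fastfood matrix, $\mathbf S\mathbf H\mathbf G\boldsymbol\Pi\mathbf H\mathbf B$ with $\mathbf S,\mathbf G,\mathbf B$ diagonal and $\boldsymbol\Pi$ a permutation matrix. The DCT and DST matrices, and every ACDC matrix $\mathbf A\mathbf C'\mathbf D\mathbf C'^{-1}$ with $\mathbf A,\mathbf D$ diagonal and $\mathbf C'\in\{\mathbf C,\mathbf C^{\top}\}$, belong to $(\mathcal M\mathcal M^*)^2_2$. Moreover, the DCT and the DST matrix are each the entrywise real part of a member of $(\mathcal M\mathcal M^*)^2$ itself. -/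

import Mathlib

open Matrix

noncomputable section

namespace Monarch

/-- Square complex matrices of size `n`, with rows and columns indexed from `0`. -/
abbrev Mat (n : ℕ) : Type := Matrix (Fin n) (Fin n) ℂ

/-! ### Monarch matrices -/

/-- Block-diagonal `n × n` matrices with diagonal blocks of size `b × b`: an entry whose row and
column lie in different blocks vanishes. -/
def blockDiagonals (b n : ℕ) : Set (Mat n) :=
  {R | ∀ i j : Fin n, i.val / b ≠ j.val / b → R i j = 0}

/-- `n × n` matrices made of `b × b` blocks, each of which is a diagonal matrix. -/
def diagBlocks (b n : ℕ) : Set (Mat n) :=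
  {L | ∀ i j : Fin n, i.val % b ≠ j.val % b → L i j = 0}

/-- Monarch matrices of size `n` and block size `b` (for `b` dividing `n`): products `L R` with
`L` a matrix of diagonal `b × b` blocks and `R` block-diagonal with blocks of size `b × b`. -/
def monarchBlock (b n : ℕ) : Set (Mat n) :=
  {M | ∃ L ∈ diagBlocks b n, ∃ R ∈ blockDiagonals b n, M = L * R}

/-- The permutation `a m + c ↦ c m + a` (`a, c < m`) of `{0, …, m² - 1}`: reshape a vector of
length `m²` into an `m × m` matrix, transpose, and flatten again. -/
def transposePerm (m : ℕ) : Equiv.Perm (Fin (m * m)) :=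
  finProdFinEquiv.symm.trans ((Equiv.prodComm (Fin m) (Fin m)).trans finProdFinEquiv)

/-- The matrix `P` of `transposePerm`. -/
def P (m : ℕ) : Mat (m * m) := (transposePerm m).permMatrix ℂ

/-- The class `𝓜⁽ⁿ⁾`, `n = m²`: matrices `P L Pᵀ R` with `L`, `R` block-diagonal, each with `m`
blocks of size `m × m`. -/
def monarch (m : ℕ) : Set (Mat (m * m)) :=
  {M | ∃ L ∈ blockDiagonals m (m * m), ∃ R ∈ blockDiagonals m (m * m), M = P m * L * (P m)ᵀ * R}

/-- `𝓒𝓒* = {A B* : A, B ∈ 𝓒}`. -/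
def mulStar {n : ℕ} (C : Set (Mat n)) : Set (Mat n) :=
  {M | ∃ A ∈ C, ∃ B ∈ C, M = A * Bᴴ}

/-- `𝓒² = {A B : A, B ∈ 𝓒}`. -/
def square {n : ℕ} (C : Set (Mat n)) : Set (Mat n) :=
  {M | ∃ A ∈ C, ∃ B ∈ C, M = A * B}

/-- The leading `n × n` submatrices of the members of a class of `en × en` matrices. -/
def leading (e n : ℕ) [NeZero e] (C : Set (Mat (e * n))) : Set (Mat n) :=
  {A | ∃ M ∈ C, A = M.submatrix
    (Fin.castLE (Nat.le_mul_of_pos_left n (NeZero.pos e)))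
    (Fin.castLE (Nat.le_mul_of_pos_left n (NeZero.pos e)))}

/-- `𝓜𝓜*` for matrices of size `n = m²`. -/
def MMstar (m : ℕ) : Set (Mat (m * m)) := mulStar (monarch m)

/-- `(𝓜𝓜*)²` for matrices of size `n = m²`. -/
def MMstarSq (m : ℕ) : Set (Mat (m * m)) := square (MMstar m)

/-- `𝓜𝓜*` with block size `m` and expansion `e`: leading `n × n` submatrices of members of `𝓜𝓜*`
of size `en × en`. -/
def MMstarExp (m n e : ℕ) [NeZero e] : Set (Mat n) :=
  leading e n (mulStar (monarchBlock m (e * n)))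

/-- `(𝓜𝓜*)²` with block size `m` and expansion `e`: leading `n × n` submatrices of members of
`(𝓜𝓜*)²` of size `en × en`. -/
def MMstarSqExp (m n e : ℕ) [NeZero e] : Set (Mat n) :=
  leading e n (square (mulStar (monarchBlock m (e * n))))

/-! ### Structured matrices -/

/-- The DFT matrix, with entries `exp(-2πi jk / n)`. -/
def dft (n : ℕ) : Mat n :=
  Matrix.of fun j k => Complex.exp (-(2 * Real.pi * Complex.I * (j.val : ℂ) * (k.val : ℂ) / (n : ℂ)))

/-- The orthonormal DCT (type II): the matrix `(w_k cos(π (2q + 1) k / (2n)))_{k,q}` with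
`w_0 = √(1/n)` and `w_k = √(2/n)` for `k ≥ 1`. -/
def dct (n : ℕ) : Matrix (Fin n) (Fin n) ℝ :=
  Matrix.of fun k q => Real.sqrt ((if k.val = 0 then 1 else 2) / (n : ℝ)) *
    Real.cos (Real.pi * (2 * (q.val : ℝ) + 1) * (k.val : ℝ) / (2 * n))

/-- The orthonormal DST (type II): the matrix `(w_k sin(π (2q + 1) (k + 1) / (2n)))_{k,q}` with
`w_{n-1} = √(1/n)` and `w_k = √(2/n)` for `k < n - 1`. -/
def dst (n : ℕ) : Matrix (Fin n) (Fin n) ℝ :=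
  Matrix.of fun k q => Real.sqrt ((if k.val + 1 = n then 1 else 2) / (n : ℝ)) *
    Real.sin (Real.pi * (2 * (q.val : ℝ) + 1) * ((k.val : ℝ) + 1) / (2 * n))

/-- A real matrix regarded as a complex one. -/
def toC {n : ℕ} (A : Matrix (Fin n) (Fin n) ℝ) : Mat n := A.map Complex.ofReal

/-- The Hadamard (Walsh–Hadamard, Sylvester) matrix, for `n` a power of two: the entry at `(i, j)`
is `-1` to the number of binary positions at which both `i` and `j` have the digit `1`. -/
def walshHadamard (n : ℕ) : Mat n :=
  Matrix.of fun i j =>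
    (-1) ^ ((Finset.range n).filter fun t => i.val.testBit t ∧ j.val.testBit t).card

/-- Circular convolutions `x ↦ h ⊛ x`, `(h ⊛ x)_i = ∑_j h_{i - j mod n} x_j`. -/
def convolutions (n : ℕ) : Set (Mat n) := {M | ∃ h : Fin n → ℂ, M = Matrix.circulant h}

/-- Toeplitz matrices `(t_{i - j})_{i,j}`. -/
def toeplitz (n : ℕ) : Set (Mat n) :=
  {T | ∃ t : ℤ → ℂ, ∀ i j : Fin n, T i j = t ((i.val : ℤ) - (j.val : ℤ))}

/-- The matrices `A C D C⁻¹` with `A`, `D` diagonal, for a fixed transform `C`. -/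
def diagTransform {n : ℕ} (C : Mat n) : Set (Mat n) :=
  {M | ∃ a d : Fin n → ℂ, M = diagonal a * C * diagonal d * C⁻¹}

/-- AFDF matrices `A F D F⁻¹`, `F` the DFT. -/
def afdf (n : ℕ) : Set (Mat n) := diagTransform (dft n)

/-- ACDC matrices `A C D C⁻¹`, `C` the DCT. Both usual conventions for `C` are included: the DCT
matrix acting on column vectors, and its transpose, which is the DCT matrix acting on row
vectors. -/
def acdc (n : ℕ) : Set (Mat n) :=
  diagTransform (toC (dct n)) ∪ diagTransform (toC (dct n)ᵀ)

/-- The `(HD)³` class: `H D₁ H D₂ H D₃` with `Dᵢ` diagonal. -/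
def hd3 (n : ℕ) : Set (Mat n) :=
  {M | ∃ d₁ d₂ d₃ : Fin n → ℂ, M = walshHadamard n * diagonal d₁ * walshHadamard n * diagonal d₂ *
    walshHadamard n * diagonal d₃}

/-- Fastfood matrices: `S H G Π H B` with `S`, `G`, `B` diagonal and `Π` a permutation matrix. -/
def fastfood (n : ℕ) : Set (Mat n) :=
  {M | ∃ (s g b : Fin n → ℂ) (σ : Equiv.Perm (Fin n)), M = diagonal s * walshHadamard n * diagonal g *
    σ.permMatrix ℂ * walshHadamard n * diagonal b}

/-! ### The two descriptions of Monarch matrices agree -/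

theorem transposePerm_val (m : ℕ) (i : Fin (m * m)) :
    (transposePerm m i).val = (i.val % m) * m + i.val / m := by
  simp [transposePerm, finProdFinEquiv, Fin.divNat, Fin.modNat]
  ring

theorem transposePerm_div (m : ℕ) (i : Fin (m * m)) :
    (transposePerm m i).val / m = i.val % m := by
  have hm : 0 < m := Nat.pos_of_ne_zero (by rintro rfl; exact absurd i.2 (by simp))
  rw [transposePerm_val, Nat.mul_comm, Nat.mul_add_div hm,
    Nat.div_eq_of_lt ((Nat.div_lt_iff_lt_mul hm).2 i.2), Nat.add_zero]

theorem transposePerm_invol (m : ℕ) (i : Fin (m * m)) :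
    transposePerm m (transposePerm m i) = i := by
  simp only [transposePerm, Equiv.trans_apply, Equiv.symm_apply_apply, Equiv.prodComm_apply,
    Prod.swap_swap, Equiv.apply_symm_apply]

theorem P_conj (m : ℕ) (A : Mat (m * m)) :
    P m * A * (P m)ᵀ = A.submatrix (transposePerm m) (transposePerm m) := by
  ext i j
  simp [P, Matrix.mul_apply, Equiv.Perm.permMatrix, PEquiv.toMatrix_apply, Equiv.symm_apply_eq]

/-- The class `𝓜⁽ⁿ⁾`, `n = m²`, is the class of Monarch matrices of block size `m`. -/
theorem monarch_eq_monarchBlock (m : ℕ) : monarch m = monarchBlock m (m * m) := by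
  ext M
  constructor
  · rintro ⟨L, hL, R, hR, rfl⟩
    refine ⟨_, ?_, R, hR, rfl⟩
    intro i j hij
    rw [P_conj]
    exact hL _ _ (by simpa [transposePerm_div] using hij)
  · rintro ⟨L, hL, R, hR, rfl⟩
    refine ⟨L.submatrix (transposePerm m) (transposePerm m), ?_, R, hR, ?_⟩
    · intro i j hij
      refine hL _ _ fun h => hij ?_
      rw [← transposePerm_div, ← transposePerm_div, transposePerm_invol, transposePerm_invol] at h
      exact h
    · rw [P_conj]
      congr 1
      ext i j
      simp [transposePerm_invol]

end Monarch

end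

/-! Write D for the matrices of diagonal blocks and B for the block-diagonal ones. Both are closed
under products and adjoints and contain the diagonal matrices. Hence the inner block-diagonal
factors of M₁M₂* merge, 𝓜𝓜* = DBD, and (𝓜𝓜*)² contains every product DBDBD. Each transform is fitted
to one of these patterns.

Circulants are the main source: a DFT on the block index, which is of type D, block-diagonalizes
them (`differenceMatrix_mem_mulStar`), and diagonal scaling on either side is free. This covers
convolutions, AFDF matrices, Toeplitz matrices as corners of circulants of twice the size, and,
through -2jk = (j-k)² - j² - k², the DFT, which thus lies already in 𝓜𝓜*.

The Hadamard matrix is a tensor product, so H = LR = RL with L in D and R in B; choosing the order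
at each occurrence lets neighbours merge. Fastfood also needs permutations in the form BDB, which is
the rearrangeability theorem `perm_eq_row_col_row`, proved by edge colouring.

The DCT and DST are real parts of a scaled DFT with permuted columns. To obtain them exactly, and
ACDC matrices too, one writes the entries as a_k (u_l g(k-l) + v_l g(k+l+s)) with g of period 2n. In
size 2n the second term is a circulant entry at the reflected index 2n-s-l, and the reflection has
the form BD (`reflection_mem_MMstarSqExp`). -/

namespace Monarch

/-! ### Closure properties of the two block structures -/

/-- Matrices whose entries vanish between different fibres of `f`. Both `blockDiagonals` and
`diagBlocks` are of this form. -/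
def fiberMatrices {n : ℕ} (f : Fin n → ℕ) : Set (Mat n) :=
  {A | ∀ i j : Fin n, f i ≠ f j → A i j = 0}

section Fiber

variable {n : ℕ} {f : Fin n → ℕ} {A B : Mat n}

theorem fiberMatrices_mul (hA : A ∈ fiberMatrices f) (hB : B ∈ fiberMatrices f) :
    A * B ∈ fiberMatrices f := by
  intro i j hij
  rw [Matrix.mul_apply]
  refine Finset.sum_eq_zero fun k _ => ?_
  by_cases h : f i = f k
  · rw [hB k j (h ▸ hij), mul_zero]
  · rw [hA i k h, zero_mul]

theorem fiberMatrices_conjTranspose (hA : A ∈ fiberMatrices f) : Aᴴ ∈ fiberMatrices f := by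
  intro i j hij
  rw [conjTranspose_apply, hA j i hij.symm, star_zero]

theorem fiberMatrices_diagonal (d : Fin n → ℂ) : diagonal d ∈ fiberMatrices f := by
  intro i j hij
  exact diagonal_apply_ne _ fun h => hij (h ▸ rfl)

theorem fiberMatrices_one : (1 : Mat n) ∈ fiberMatrices f := by
  rw [← diagonal_one]
  exact fiberMatrices_diagonal _

theorem fiberMatrices_permMatrix {σ : Equiv.Perm (Fin n)} (h : ∀ i, f (σ i) = f i) :
    σ.permMatrix ℂ ∈ fiberMatrices f := by
  intro i j hij
  have : σ i ≠ j := fun e => hij (by rw [← e, h])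
  simp [Equiv.Perm.permMatrix, PEquiv.toMatrix_apply, this]

end Fiber

/-! ### The classes `𝓜𝓜*` and `(𝓜𝓜*)²` in terms of block structures -/

section Classes

variable {b n : ℕ}

/-- The two block-diagonal factors of M₁M₂* are adjacent and merge into one; conversely, the second
Monarch matrix may have trivial block-diagonal part. -/
theorem mem_mulStar_monarchBlock_iff {M : Mat n} :
    M ∈ mulStar (monarchBlock b n) ↔
      ∃ L ∈ diagBlocks b n, ∃ R ∈ blockDiagonals b n, ∃ L' ∈ diagBlocks b n, M = L * R * L' := by
  constructor
  · rintro ⟨_, ⟨L, hL, R, hR, rfl⟩, _, ⟨L', hL', R', hR', rfl⟩, rfl⟩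
    refine ⟨L, hL, R * R'ᴴ, fiberMatrices_mul hR (fiberMatrices_conjTranspose hR'), L'ᴴ,
      fiberMatrices_conjTranspose hL', ?_⟩
    simp only [conjTranspose_mul, Matrix.mul_assoc]
  · rintro ⟨L, hL, R, hR, L', hL', rfl⟩
    refine ⟨L * R, ⟨L, hL, R, hR, rfl⟩, L'ᴴ, ⟨L'ᴴ, fiberMatrices_conjTranspose hL', 1,
      fiberMatrices_one, (Matrix.mul_one _).symm⟩, ?_⟩
    rw [conjTranspose_conjTranspose]

theorem diagonal_mul_mem_mulStar {M : Mat n} (hM : M ∈ mulStar (monarchBlock b n))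
    (d : Fin n → ℂ) : diagonal d * M ∈ mulStar (monarchBlock b n) := by
  obtain ⟨L, hL, R, hR, L', hL', rfl⟩ := mem_mulStar_monarchBlock_iff.1 hM
  exact mem_mulStar_monarchBlock_iff.2 ⟨diagonal d * L,
    fiberMatrices_mul (fiberMatrices_diagonal d) hL, R, hR, L', hL',
    by simp only [Matrix.mul_assoc]⟩

theorem mul_diagonal_mem_mulStar {M : Mat n} (hM : M ∈ mulStar (monarchBlock b n))
    (d : Fin n → ℂ) : M * diagonal d ∈ mulStar (monarchBlock b n) := by
  obtain ⟨L, hL, R, hR, L', hL', rfl⟩ := mem_mulStar_monarchBlock_iff.1 hM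
  exact mem_mulStar_monarchBlock_iff.2 ⟨L, hL, R, hR, L' * diagonal d,
    fiberMatrices_mul hL' (fiberMatrices_diagonal d), by simp only [Matrix.mul_assoc]⟩

theorem mul_mem_mulStar {R L : Mat n} (hR : R ∈ blockDiagonals b n) (hL : L ∈ diagBlocks b n) :
    R * L ∈ mulStar (monarchBlock b n) :=
  mem_mulStar_monarchBlock_iff.2 ⟨1, fiberMatrices_one, R, hR, L, hL, by rw [Matrix.one_mul]⟩

theorem one_mem_mulStar : (1 : Mat n) ∈ mulStar (monarchBlock b n) := by
  simpa using mul_mem_mulStar (b := b) (n := n) fiberMatrices_one fiberMatrices_one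

theorem mem_square_of_factors {L₁ R₁ L₂ R₂ L₃ : Mat n} (hL₁ : L₁ ∈ diagBlocks b n)
    (hR₁ : R₁ ∈ blockDiagonals b n) (hL₂ : L₂ ∈ diagBlocks b n) (hR₂ : R₂ ∈ blockDiagonals b n)
    (hL₃ : L₃ ∈ diagBlocks b n) :
    L₁ * R₁ * L₂ * R₂ * L₃ ∈ square (mulStar (monarchBlock b n)) :=
  ⟨_, mem_mulStar_monarchBlock_iff.2 ⟨L₁, hL₁, R₁, hR₁, L₂, hL₂, rfl⟩, _,
    mul_mem_mulStar hR₂ hL₃, by simp only [Matrix.mul_assoc]⟩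

theorem MMstar_eq (m : ℕ) : MMstar m = mulStar (monarchBlock m (m * m)) := by
  rw [MMstar, monarch_eq_monarchBlock]

theorem MMstarSq_eq (m : ℕ) : MMstarSq m = square (mulStar (monarchBlock m (m * m))) := by
  rw [MMstarSq, MMstar_eq]

end Classes

/-! ### Rearrangeability: permutations of a grid as products of row and column permutations -/

section Rearrangeable

open Finset

/-- A regular bipartite multigraph has a perfect matching. -/
theorem exists_perfect_matching {E A : Type*} [Fintype A] [DecidableEq E] [DecidableEq A]
    (s t : E → A) (S : Finset E) (d : ℕ) (hd : 0 < d)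
    (hs : ∀ a, (S.filter fun e => s e = a).card = d)
    (ht : ∀ a, (S.filter fun e => t e = a).card = d) :
    ∃ g : A → E, (∀ a, g a ∈ S) ∧ (∀ a, s (g a) = a) ∧ Function.Bijective fun a => t (g a) := by
  have key := (Finset.all_card_le_biUnion_card_iff_exists_injective
    (fun a => (S.filter fun e => s e = a).image t)).1 ?_
  · obtain ⟨f, hf, hmem⟩ := key
    have : ∀ a, ∃ e ∈ S, s e = a ∧ t e = f a := fun a => by
      obtain ⟨e, he, h⟩ := Finset.mem_image.1 (hmem a)
      obtain ⟨h1, h2⟩ := Finset.mem_filter.1 he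
      exact ⟨e, h1, h2, h⟩
    choose g hg1 hg2 hg3 using this
    refine ⟨g, hg1, hg2, ?_⟩
    simp only [hg3]
    exact Finite.injective_iff_bijective.1 hf
  · intro X
    -- Hall's condition by double counting: the d|X| edges leaving X are among the d|N(X)| edges
    -- entering its neighbourhood.
    refine Nat.le_of_mul_le_mul_right ?_ hd
    rw [← Finset.sum_const_nat (s := X) (m := d) fun a _ => hs a,
      ← Finset.sum_const_nat (s := X.biUnion _) (m := d) fun a _ => ht a,
      ← Finset.card_biUnion, ← Finset.card_biUnion]
    · refine Finset.card_le_card fun e he => ?_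
      simp only [Finset.mem_biUnion, Finset.mem_filter, Finset.mem_image] at he ⊢
      obtain ⟨a, ha, he, hea⟩ := he
      exact ⟨t e, ⟨a, ha, e, ⟨he, hea⟩, rfl⟩, he, rfl⟩
    · intro x _ y _ hxy
      refine Finset.disjoint_left.2 fun e he he' => hxy ?_
      rw [← (Finset.mem_filter.1 he).2, ← (Finset.mem_filter.1 he').2]
    · intro x _ y _ hxy
      refine Finset.disjoint_left.2 fun e he he' => hxy ?_
      rw [← (Finset.mem_filter.1 he).2, ← (Finset.mem_filter.1 he').2]

/-- A `d`-regular bipartite multigraph has a proper edge colouring with `d` colours. -/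
theorem exists_edge_colouring {E A : Type*} [Fintype A] [DecidableEq E] [DecidableEq A]
    (s t : E → A) (d : ℕ) : ∀ S : Finset E,
    (∀ a, (S.filter fun e => s e = a).card = d) → (∀ a, (S.filter fun e => t e = a).card = d) →
    ∃ col : E → ℕ, (∀ e ∈ S, col e < d) ∧
      (∀ e ∈ S, ∀ e' ∈ S, s e = s e' → col e = col e' → e = e') ∧
      (∀ e ∈ S, ∀ e' ∈ S, t e = t e' → col e = col e' → e = e') := by
  induction d with
  | zero =>
    intro S hs _
    have hS : ∀ e, e ∉ S := fun e he => by
      have := Finset.card_eq_zero.1 (hs (s e))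
      exact Finset.notMem_empty e (this ▸ Finset.mem_filter.2 ⟨he, rfl⟩)
    exact ⟨fun _ => 0, fun e he => absurd he (hS e), fun e he => absurd he (hS e),
      fun e he => absurd he (hS e)⟩
  | succ d ih =>
    intro S hs ht
    -- Removing a perfect matching leaves a `d`-regular multigraph; the matching receives the new
    -- colour `d`.
    obtain ⟨g, hgS, hgs, hgt⟩ := exists_perfect_matching s t S (d + 1) d.succ_pos hs ht
    have hgmem : ∀ e, e ∈ univ.image g ↔ g (s e) = e := fun e => by
      simp only [Finset.mem_image, Finset.mem_univ, true_and]
      exact ⟨by rintro ⟨a, rfl⟩; rw [hgs], fun h => ⟨_, h⟩⟩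
    have hs' : ∀ a, ((S \ univ.image g).filter fun e => s e = a).card = d := fun a => by
      have : (S \ univ.image g).filter (fun e => s e = a)
          = (S.filter fun e => s e = a).erase (g a) := by
        ext e
        simp only [Finset.mem_filter, Finset.mem_sdiff, Finset.mem_erase, hgmem]
        constructor
        · rintro ⟨⟨h1, h2⟩, rfl⟩
          exact ⟨fun h => h2 h.symm, h1, rfl⟩
        · rintro ⟨h1, h2, rfl⟩
          exact ⟨⟨h2, fun h => h1 h.symm⟩, rfl⟩
      rw [this, Finset.card_erase_of_mem (Finset.mem_filter.2 ⟨hgS a, hgs a⟩), hs]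
      rfl
    have ht' : ∀ a, ((S \ univ.image g).filter fun e => t e = a).card = d := fun a => by
      obtain ⟨x, hx⟩ := hgt.2 a
      have : (S \ univ.image g).filter (fun e => t e = a)
          = (S.filter fun e => t e = a).erase (g x) := by
        ext e
        simp only [Finset.mem_filter, Finset.mem_sdiff, Finset.mem_erase, hgmem]
        constructor
        · rintro ⟨⟨h1, h2⟩, rfl⟩
          exact ⟨fun h => h2 (by rw [h, hgs]), h1, rfl⟩
        · rintro ⟨h1, h2, rfl⟩
          refine ⟨⟨h2, fun h => h1 ?_⟩, rfl⟩
          rw [← h, hgt.1 (show t (g (s e)) = t (g x) by rw [h]; exact hx.symm)]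
      rw [this, Finset.card_erase_of_mem (Finset.mem_filter.2 ⟨hgS x, hx⟩), ht]
      rfl
    obtain ⟨col, h1, h2, h3⟩ := ih _ hs' ht'
    have hlt : ∀ e ∈ S, g (s e) ≠ e → col e < d := fun e he hne =>
      h1 e (Finset.mem_sdiff.2 ⟨he, fun h => hne ((hgmem e).1 h)⟩)
    have hsd : ∀ e ∈ S, g (s e) ≠ e → e ∈ S \ univ.image g := fun e he hne =>
      Finset.mem_sdiff.2 ⟨he, fun h => hne ((hgmem e).1 h)⟩
    refine ⟨fun e => if g (s e) = e then d else col e, ?_, ?_, ?_⟩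
    · intro e he
      dsimp only
      split_ifs with h
      · exact d.lt_succ_self
      · exact (hlt e he h).trans d.lt_succ_self
    · intro e he e' he' hee hc
      dsimp only at hc
      split_ifs at hc with h h' h'
      · rw [← h, ← h', hee]
      · exact absurd hc (hlt e' he' h').ne'
      · exact absurd hc (hlt e he h).ne
      · exact h2 e (hsd e he h) e' (hsd e' he' h') hee hc
    · intro e he e' he' hee hc
      dsimp only at hc
      split_ifs at hc with h h' h'
      · rw [← h, ← h', hgt.1 (show t (g (s e)) = t (g (s e')) by rw [h, h', hee])]
      · exact absurd hc (hlt e' he' h').ne'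
      · exact absurd hc (hlt e he h).ne
      · exact h3 e (hsd e he h) e' (hsd e' he' h') hee hc

/-- Every permutation of a grid is a permutation within rows, followed by one within columns,
followed by one within rows. -/
theorem perm_eq_row_col_row {A C : Type*} [Fintype A] [Fintype C] [DecidableEq A] [DecidableEq C]
    (σ : Equiv.Perm (A × C)) :
    ∃ r₂ l r₁ : Equiv.Perm (A × C), σ = r₂ * l * r₁ ∧ (∀ x, (r₁ x).1 = x.1) ∧
      (∀ x, (l x).2 = x.2) ∧ ∀ x, (r₂ x).1 = x.1 := by
  have hfib : ∀ a : A, (univ.filter fun e : A × C => e.1 = a).card = Fintype.card C := fun a => by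
    have : univ.filter (fun e : A × C => e.1 = a) = univ.image fun c : C => (a, c) := by
      ext ⟨x, y⟩
      simp [eq_comm]
    rw [this, Finset.card_image_of_injective _ (Prod.mk_right_injective a), Finset.card_univ]
  have hfib' : ∀ a : A, (univ.filter fun e : A × C => (σ e).1 = a).card = Fintype.card C := by
    intro a
    rw [← hfib a]
    exact Finset.card_bij (fun e _ => σ e) (by simp) (fun _ _ _ _ h => σ.injective h)
      fun e he => ⟨σ.symm e, by simpa using he, by simp⟩
  -- Each grid point is an edge from its own row to the row of its image. Its colour serves as the
  -- column through which it travels, and properness says that no two points collide.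
  obtain ⟨col, h1, h2, h3⟩ := exists_edge_colouring (fun e : A × C => e.1) (fun e => (σ e).1)
    (Fintype.card C) univ hfib hfib'
  let k : A × C → C := fun e => (Fintype.equivFin C).symm ⟨col e, h1 e (mem_univ e)⟩
  have hk : ∀ e e', k e = k e' → col e = col e' := fun e e' h => by
    simpa [k] using h
  have b1 : Function.Bijective fun e : A × C => (e.1, k e) :=
    Finite.injective_iff_bijective.1 fun e e' h => h2 e (mem_univ _) e' (mem_univ _)
      (Prod.ext_iff.1 h).1 (hk _ _ (Prod.ext_iff.1 h).2)
  have b2 : Function.Bijective fun e : A × C => ((σ e).1, k e) :=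
    Finite.injective_iff_bijective.1 fun e e' h => h3 e (mem_univ _) e' (mem_univ _)
      (Prod.ext_iff.1 h).1 (hk _ _ (Prod.ext_iff.1 h).2)
  let r : Equiv.Perm (A × C) := Equiv.ofBijective _ b1
  let q : Equiv.Perm (A × C) := Equiv.ofBijective _ b2
  -- The route of `e` is `e`, then `(e.1, k e)`, then `((σ e).1, k e)`, then `σ e`.
  refine ⟨σ * q⁻¹, q * r⁻¹, r, by group, fun x => rfl, fun x => ?_, fun x => ?_⟩
  · obtain ⟨e, rfl⟩ := r.surjective x
    rw [Equiv.Perm.mul_apply, Equiv.Perm.inv_def, Equiv.symm_apply_apply]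
    rfl
  · obtain ⟨e, rfl⟩ := q.surjective x
    rw [Equiv.Perm.mul_apply, Equiv.Perm.inv_def, Equiv.symm_apply_apply]
    rfl

end Rearrangeable

/-! ### Permutation matrices as products of block structures -/

theorem finProdFinEquiv_val_div {p m : ℕ} (x : Fin p × Fin m) :
    (finProdFinEquiv x).val / m = x.1.val := by
  have hm : 0 < m := Fin.pos x.2
  rw [finProdFinEquiv_apply_val, Nat.add_mul_div_left _ _ hm, Nat.div_eq_of_lt x.2.2, Nat.zero_add]

theorem finProdFinEquiv_val_mod {p m : ℕ} (x : Fin p × Fin m) :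
    (finProdFinEquiv x).val % m = x.2.val := by
  rw [finProdFinEquiv_apply_val, Nat.add_mul_mod_self_left, Nat.mod_eq_of_lt x.2.2]

theorem permMatrix_eq_block_diag_block {p m : ℕ} (σ : Equiv.Perm (Fin (p * m))) :
    ∃ R₁ ∈ blockDiagonals m (p * m), ∃ L ∈ diagBlocks m (p * m), ∃ R₂ ∈ blockDiagonals m (p * m),
      σ.permMatrix ℂ = R₁ * L * R₂ := by
  let e : Fin p × Fin m ≃ Fin (p * m) := finProdFinEquiv
  obtain ⟨r₂, l, r₁, h, h1, hl, h2⟩ := perm_eq_row_col_row (e.symm.permCongr σ)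
  -- `permMatrix` reverses products, so the permutation applied first gives the leftmost factor.
  refine ⟨_, fiberMatrices_permMatrix (σ := e.permCongr r₁) ?_, _,
    fiberMatrices_permMatrix (σ := e.permCongr l) ?_, _,
    fiberMatrices_permMatrix (σ := e.permCongr r₂) ?_, ?_⟩
  · intro i
    obtain ⟨x, rfl⟩ := e.surjective i
    simp [e, Equiv.permCongr_apply, finProdFinEquiv_val_div, h1, -finProdFinEquiv_apply_val]
  · intro i
    obtain ⟨x, rfl⟩ := e.surjective i
    simp [e, Equiv.permCongr_apply, finProdFinEquiv_val_mod, hl, -finProdFinEquiv_apply_val]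
  · intro i
    obtain ⟨x, rfl⟩ := e.surjective i
    simp [e, Equiv.permCongr_apply, finProdFinEquiv_val_div, h2, -finProdFinEquiv_apply_val]
  · rw [← permMatrix_mul, ← permMatrix_mul]
    congr 1
    ext i
    have := congrArg e (Equiv.congr_fun h (e.symm i))
    simpa [Equiv.permCongr_apply, Equiv.Perm.mul_apply] using congrArg Fin.val this

/-- The same decomposition on the transposed grid: its rows are the residue classes modulo `m`, so
the two types of factor exchange roles. -/
theorem permMatrix_mem_mulStar {p m : ℕ} (σ : Equiv.Perm (Fin (p * m))) :
    σ.permMatrix ℂ ∈ mulStar (monarchBlock m (p * m)) := by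
  let e : Fin m × Fin p ≃ Fin (p * m) := (Equiv.prodComm _ _).trans finProdFinEquiv
  obtain ⟨r₂, l, r₁, h, h1, hl, h2⟩ := perm_eq_row_col_row (e.symm.permCongr σ)
  refine mem_mulStar_monarchBlock_iff.2 ⟨_,
    fiberMatrices_permMatrix (σ := e.permCongr r₁) ?_, _,
    fiberMatrices_permMatrix (σ := e.permCongr l) ?_, _,
    fiberMatrices_permMatrix (σ := e.permCongr r₂) ?_, ?_⟩
  · intro i
    obtain ⟨x, rfl⟩ := e.surjective i
    simp [e, Equiv.permCongr_apply, finProdFinEquiv_val_mod, h1, -finProdFinEquiv_apply_val]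
  · intro i
    obtain ⟨x, rfl⟩ := e.surjective i
    simp [e, Equiv.permCongr_apply, finProdFinEquiv_val_div, hl, -finProdFinEquiv_apply_val]
  · intro i
    obtain ⟨x, rfl⟩ := e.surjective i
    simp [e, Equiv.permCongr_apply, finProdFinEquiv_val_mod, h2, -finProdFinEquiv_apply_val]
  · rw [← permMatrix_mul, ← permMatrix_mul]
    congr 1
    ext i
    have := congrArg e (Equiv.congr_fun h (e.symm i))
    simpa [Equiv.permCongr_apply, Equiv.Perm.mul_apply] using congrArg Fin.val this

/-! ### The Hadamard matrix -/

/-- The number of binary positions below `K` at which both `i` and `j` have digit `1`. -/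
def commonOnes (K i j : ℕ) : ℕ :=
  ((Finset.range K).filter fun t => i.testBit t ∧ j.testBit t).card

/-- Splitting the binary digits into low and high ones makes the Hadamard sign multiplicative, that
is, a tensor product. -/
theorem commonOnes_split (k r i j : ℕ) :
    commonOnes (k + r) i j =
      commonOnes k (i % 2 ^ k) (j % 2 ^ k) + commonOnes r (i / 2 ^ k) (j / 2 ^ k) := by
  simp only [commonOnes, Finset.card_filter]
  rw [Finset.sum_range_add]
  congr 1
  · refine Finset.sum_congr rfl fun t ht => ?_
    have := Finset.mem_range.1 ht
    simp [Nat.testBit_mod_two_pow, this]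
  · refine Finset.sum_congr rfl fun t _ => ?_
    simp [Nat.testBit_div_two_pow, Nat.add_comm k t]

theorem eq_of_div_eq_of_mod_eq {m i j : ℕ} (h : i / m = j / m) (h' : i % m = j % m) : i = j := by
  rw [← Nat.div_add_mod i m, ← Nat.div_add_mod j m, h, h']

/-- The index of the grid point in the row of `i` and the column of `j`. -/
def gridPoint {m : ℕ} (i j : Fin (m * m)) : Fin (m * m) :=
  finProdFinEquiv (i.divNat, j.modNat)

theorem gridPoint_div {m : ℕ} (i j : Fin (m * m)) : (gridPoint i j).val / m = i.val / m := by
  rw [gridPoint, finProdFinEquiv_val_div]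
  rfl

theorem gridPoint_mod {m : ℕ} (i j : Fin (m * m)) : (gridPoint i j).val % m = j.val % m := by
  rw [gridPoint, finProdFinEquiv_val_mod]
  rfl

/-- The Hadamard matrix is a product, in either order, of a matrix of diagonal blocks and a
block-diagonal matrix. -/
theorem walshHadamard_factor (k : ℕ) :
    ∃ L ∈ diagBlocks (2 ^ k) (2 ^ k * 2 ^ k), ∃ R ∈ blockDiagonals (2 ^ k) (2 ^ k * 2 ^ k),
      walshHadamard (2 ^ k * 2 ^ k) = L * R ∧ walshHadamard (2 ^ k * 2 ^ k) = R * L := by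
  obtain ⟨r, hr⟩ : ∃ r, 2 ^ k * 2 ^ k = k + r :=
    Nat.exists_eq_add_of_le (k.lt_two_pow_self.le.trans (Nat.le_mul_self _))
  -- The two tensor factors, acting on the high digits and on the low digits; they commute.
  let L : Mat (2 ^ k * 2 ^ k) := Matrix.of fun i j =>
    if i.val % 2 ^ k = j.val % 2 ^ k then
      (-1) ^ commonOnes r (i.val / 2 ^ k) (j.val / 2 ^ k) else 0
  let R : Mat (2 ^ k * 2 ^ k) := Matrix.of fun i j =>
    if i.val / 2 ^ k = j.val / 2 ^ k then
      (-1) ^ commonOnes k (i.val % 2 ^ k) (j.val % 2 ^ k) else 0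
  have hH : ∀ i j, walshHadamard (2 ^ k * 2 ^ k) i j =
      (-1) ^ commonOnes k (i.val % 2 ^ k) (j.val % 2 ^ k) *
        (-1) ^ commonOnes r (i.val / 2 ^ k) (j.val / 2 ^ k) := fun i j => by
    rw [← pow_add (-1 : ℂ), ← commonOnes_split]
    exact congrArg (fun K => (-1 : ℂ) ^ commonOnes K i.val j.val) hr
  refine ⟨L, fun i j h => if_neg h, R, fun i j h => if_neg h, ?_, ?_⟩
  · ext i j
    rw [hH, Matrix.mul_apply, Finset.sum_eq_single (gridPoint j i)]
    · simp only [L, R, Matrix.of_apply, gridPoint_div, gridPoint_mod, if_true, mul_comm]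
    · intro l _ hl
      by_cases h1 : i.val % 2 ^ k = l.val % 2 ^ k
      · by_cases h2 : l.val / 2 ^ k = j.val / 2 ^ k
        · exact absurd (Fin.ext (eq_of_div_eq_of_mod_eq (h2.trans (gridPoint_div j i).symm)
            (h1.symm.trans (gridPoint_mod j i).symm))) hl
        · simp [R, h2]
      · simp [L, h1]
    · simp
  · ext i j
    rw [hH, Matrix.mul_apply, Finset.sum_eq_single (gridPoint i j)]
    · simp only [L, R, Matrix.of_apply, gridPoint_div, gridPoint_mod, if_true]
    · intro l _ hl
      by_cases h1 : i.val / 2 ^ k = l.val / 2 ^ k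
      · by_cases h2 : l.val % 2 ^ k = j.val % 2 ^ k
        · exact absurd (Fin.ext (eq_of_div_eq_of_mod_eq (h1.symm.trans (gridPoint_div i j).symm)
            (h2.trans (gridPoint_mod i j).symm))) hl
        · simp [L, h2]
      · simp [R, h1]
    · simp

theorem walshHadamard_mem_MMstar {m : ℕ} (hm : ∃ k : ℕ, m = 2 ^ k) :
    walshHadamard (m * m) ∈ MMstar m := by
  obtain ⟨k, rfl⟩ := hm
  obtain ⟨L, hL, R, hR, h, -⟩ := walshHadamard_factor k
  rw [MMstar_eq, h]
  exact mem_mulStar_monarchBlock_iff.2 ⟨L, hL, R, hR, 1, fiberMatrices_one, (mul_one _).symm⟩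

/-- Expanding the three Hadamard factors as LR, RL, LR puts equal types next to each other across
the diagonal matrices. -/
theorem hd3_subset {m : ℕ} (hm : ∃ k : ℕ, m = 2 ^ k) : hd3 (m * m) ⊆ MMstarSq m := by
  obtain ⟨k, rfl⟩ := hm
  obtain ⟨L, hL, R, hR, h, h'⟩ := walshHadamard_factor k
  rintro _ ⟨d₁, d₂, d₃, rfl⟩
  have : walshHadamard (2 ^ k * 2 ^ k) * diagonal d₁ * walshHadamard (2 ^ k * 2 ^ k) *
      diagonal d₂ * walshHadamard (2 ^ k * 2 ^ k) * diagonal d₃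
      = L * (R * diagonal d₁ * R) * (L * diagonal d₂ * L) * R * diagonal d₃ := by
    calc _ = (L * R) * diagonal d₁ * (R * L) * diagonal d₂ * (L * R) * diagonal d₃ := by
          rw [← h, ← h']
      _ = _ := by simp only [Matrix.mul_assoc]
  rw [MMstarSq_eq, this]
  exact mem_square_of_factors hL
    (fiberMatrices_mul (fiberMatrices_mul hR (fiberMatrices_diagonal _)) hR)
    (fiberMatrices_mul (fiberMatrices_mul hL (fiberMatrices_diagonal _)) hL) hR
    (fiberMatrices_diagonal _)

/-- With H = LR on the left, H = RL on the right and the permutation in block-diagonal,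
diagonal-block, block-diagonal form, its outer factors merge with both copies of R. -/
theorem fastfood_subset {m : ℕ} (hm : ∃ k : ℕ, m = 2 ^ k) : fastfood (m * m) ⊆ MMstarSq m := by
  obtain ⟨k, rfl⟩ := hm
  obtain ⟨L, hL, R, hR, h, h'⟩ := walshHadamard_factor k
  rintro _ ⟨s, g, b, σ, rfl⟩
  obtain ⟨R₁, hR₁, Lσ, hLσ, R₂, hR₂, hσ⟩ := permMatrix_eq_block_diag_block σ
  have : diagonal s * walshHadamard (2 ^ k * 2 ^ k) * diagonal g * σ.permMatrix ℂ *
      walshHadamard (2 ^ k * 2 ^ k) * diagonal b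
      = (diagonal s * L) * (R * diagonal g * R₁) * Lσ * (R₂ * R) * (L * diagonal b) := by
    calc _ = diagonal s * (L * R) * diagonal g * (R₁ * Lσ * R₂) * (R * L) * diagonal b := by
          rw [← h, ← h', ← hσ]
      _ = _ := by simp only [Matrix.mul_assoc]
  rw [MMstarSq_eq, this]
  exact mem_square_of_factors (fiberMatrices_mul (fiberMatrices_diagonal _) hL)
    (fiberMatrices_mul (fiberMatrices_mul hR (fiberMatrices_diagonal _)) hR₁) hLσ
    (fiberMatrices_mul hR₂ hR) (fiberMatrices_mul hL (fiberMatrices_diagonal _))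

/-! ### Circulant matrices -/

/-- The matrix `(g (i - j))_{i,j}`. -/
def differenceMatrix (n : ℕ) (g : ℤ → ℂ) : Mat n :=
  Matrix.of fun i j => g ((i.val : ℤ) - (j.val : ℤ))

/-- Orthogonality of the characters of `ℤ/p`. -/
theorem sum_zpow_of_isPrimitiveRoot {p : ℕ} [NeZero p] {ζ : ℂ} (hζ : IsPrimitiveRoot ζ p) (x : ℤ) :
    ∑ a : Fin p, ζ ^ ((a.val : ℤ) * x) = if (p : ℤ) ∣ x then (p : ℂ) else 0 := by
  have hp : (ζ ^ x) ^ p = 1 := by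
    rw [← zpow_natCast, ← _root_.zpow_mul, mul_comm, _root_.zpow_mul, zpow_natCast, hζ.pow_eq_one, _root_.one_zpow]
  have hsum : ∑ a : Fin p, ζ ^ ((a.val : ℤ) * x) = ∑ a ∈ Finset.range p, (ζ ^ x) ^ a := by
    rw [Finset.sum_range]
    refine Finset.sum_congr rfl fun a _ => ?_
    rw [← zpow_natCast, ← _root_.zpow_mul, mul_comm]
  rw [hsum]
  split_ifs with h
  · rw [(hζ.zpow_eq_one_iff_dvd x).2 h]
    simp
  · have h1 : ζ ^ x ≠ 1 := fun e => h ((hζ.zpow_eq_one_iff_dvd x).1 e)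
    rw [geom_sum_eq h1, hp, sub_self, zero_div]

theorem sum_ite_mod_eq {p m : ℕ} (F : ℕ → ℂ) (i : Fin (p * m)) :
    ∑ k : Fin (p * m), (if i.val % m = k.val % m then F (k.val / m) else 0)
      = ∑ a : Fin p, F a := by
  rw [← finProdFinEquiv.sum_comp, Fintype.sum_prod_type]
  refine Finset.sum_congr rfl fun a _ => ?_
  simp only [finProdFinEquiv_val_div, finProdFinEquiv_val_mod]
  rw [Finset.sum_eq_single i.modNat]
  · exact if_pos rfl
  · intro c _ hc
    exact if_neg fun h => hc (Fin.ext h.symm)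
  · simp

/-- Circulant matrices of size `p m` are block-circulant with `m × m` blocks, hence
block-diagonalized by a DFT of size `p` acting on the block index. -/
theorem differenceMatrix_mem_mulStar {p m n : ℕ} (hn : n = p * m) {g : ℤ → ℂ}
    (hg : Function.Periodic g n) : differenceMatrix n g ∈ mulStar (monarchBlock m n) := by
  subst hn
  rcases Nat.eq_zero_or_pos p with rfl | hp
  · have : differenceMatrix (0 * m) g = 1 := by
      ext i
      exact absurd i.2 (by simp)
    rw [this]
    exact one_mem_mulStar
  have : NeZero p := ⟨hp.ne'⟩
  obtain ⟨ζ, hζ⟩ : ∃ ζ : ℂ, IsPrimitiveRoot ζ p := ⟨_, Complex.isPrimitiveRoot_exp p hp.ne'⟩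
  have hζ0 : ζ ≠ 0 := hζ.ne_zero hp.ne'
  let L : Mat (p * m) := Matrix.of fun i j =>
    if i.val % m = j.val % m then (p : ℂ)⁻¹ * ζ ^ ((j.val / m : ℕ) * (i.val / m : ℕ) : ℤ) else 0
  let L' : Mat (p * m) := Matrix.of fun i j =>
    if i.val % m = j.val % m then ζ ^ (-((i.val / m : ℕ) * (j.val / m : ℕ) : ℤ)) else 0
  -- The block at frequency `a` is the Fourier transform of the circulant's blocks over the block
  -- displacement `δ`.
  let r : ℕ → ℕ → ℕ → ℂ := fun a c c' =>
    ∑ δ : Fin p, g (δ.val * m + c - c') * ζ ^ (-((a : ℤ) * δ.val))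
  let R : Mat (p * m) := Matrix.of fun i j =>
    if i.val / m = j.val / m then r (i.val / m) (i.val % m) (j.val % m) else 0
  refine mem_mulStar_monarchBlock_iff.2 ⟨L, fun i j h => if_neg h, R, fun i j h => if_neg h,
    L', fun i j h => if_neg h, ?_⟩
  ext i j
  have hRL : ∀ k, (R * L') k j =
      r (k.val / m) (k.val % m) (j.val % m) * ζ ^ (-((k.val / m : ℕ) * (j.val / m : ℕ) : ℤ)) := by
    intro k
    rw [Matrix.mul_apply, Finset.sum_eq_single (finProdFinEquiv (k.divNat, j.modNat))]
    · have h1 : (finProdFinEquiv (k.divNat, j.modNat)).val / m = k.val / m :=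
        finProdFinEquiv_val_div _
      have h2 : (finProdFinEquiv (k.divNat, j.modNat)).val % m = j.val % m :=
        finProdFinEquiv_val_mod _
      simp only [R, L', Matrix.of_apply, h1, h2, if_true]
    · intro l _ hl
      by_cases h1 : k.val / m = l.val / m
      · by_cases h2 : l.val % m = j.val % m
        · refine absurd (Fin.ext (eq_of_div_eq_of_mod_eq (m := m) ?_ ?_)) hl
          · rw [finProdFinEquiv_val_div, ← h1]; rfl
          · rw [finProdFinEquiv_val_mod, h2]; rfl
        · simp [L', h2]
      · simp [R, h1]
    · simp
  rw [Matrix.mul_assoc, Matrix.mul_apply]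
  simp only [hRL]
  let F : ℕ → ℂ := fun a => (p : ℂ)⁻¹ * ζ ^ ((a * (i.val / m : ℕ) : ℤ)) *
    (r a (i.val % m) (j.val % m) * ζ ^ (-(a * (j.val / m : ℕ) : ℤ)))
  have hterm : ∀ k : Fin (p * m), L i k * (r (k.val / m) (k.val % m) (j.val % m) *
      ζ ^ (-((k.val / m : ℕ) * (j.val / m : ℕ) : ℤ))) =
      if i.val % m = k.val % m then F (k.val / m) else 0 := by
    intro k
    by_cases h : i.val % m = k.val % m
    · simp only [L, F, Matrix.of_apply, h, if_true]
    · simp only [L, Matrix.of_apply, h, if_false, zero_mul]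
  rw [Finset.sum_congr rfl fun k _ => hterm k, sum_ite_mod_eq F i]
  have hcomb : ∀ a : Fin p, F a =
      ∑ δ : Fin p, (p : ℂ)⁻¹ * g (δ.val * m + (i.val % m : ℕ) - (j.val % m : ℕ)) *
        ζ ^ ((a.val : ℤ) * ((i.val / m : ℕ) - (j.val / m : ℕ) - δ.val)) := by
    intro a
    simp only [F, r, Finset.sum_mul, Finset.mul_sum]
    refine Finset.sum_congr rfl fun δ _ => ?_
    have : (a.val : ℤ) * ((i.val / m : ℕ) - (j.val / m : ℕ) - δ.val) =
      (a.val * (i.val / m : ℕ) : ℤ) + -((a.val : ℤ) * δ.val) + -(a.val * (j.val / m : ℕ) : ℤ) := by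
      ring
    rw [this, zpow_add₀ hζ0, zpow_add₀ hζ0]
    ring
  -- Summing over the frequency first, orthogonality keeps only the displacement congruent to the
  -- block difference modulo `p`.
  rw [Finset.sum_congr rfl fun a _ => hcomb a, Finset.sum_comm]
  simp only [← Finset.mul_sum, sum_zpow_of_isPrimitiveRoot hζ]
  have hp0 : (p : ℤ) ≠ 0 := by exact_mod_cast hp.ne'
  let x : ℤ := (i.val / m : ℕ) - (j.val / m : ℕ)
  obtain ⟨d, hd⟩ : ∃ d : ℕ, (d : ℤ) = x % p := ⟨(x % p).toNat, Int.toNat_of_nonneg (Int.emod_nonneg _ hp0)⟩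
  have hdp : d < p := by
    have := Int.emod_lt_of_pos x (show (0 : ℤ) < p by exact_mod_cast hp)
    omega
  rw [Finset.sum_eq_single (⟨d, hdp⟩ : Fin p)]
  · have h1 : (p : ℤ) ∣ x - d := by rw [hd]; exact Int.dvd_self_sub_emod
    rw [if_pos h1]
    obtain ⟨q, hq⟩ := h1
    have h2 : ((d : ℤ) * m + (i.val % m : ℕ) - (j.val % m : ℕ)) =
        (i.val : ℤ) - j.val - q * ((p * m : ℕ) : ℤ) := by
      have hi : (i.val : ℤ) = m * (i.val / m : ℕ) + (i.val % m : ℕ) := by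
        exact_mod_cast (Nat.div_add_mod i.val m).symm
      have hj : (j.val : ℤ) = m * (j.val / m : ℕ) + (j.val % m : ℕ) := by
        exact_mod_cast (Nat.div_add_mod j.val m).symm
      have hdx : (d : ℤ) = (i.val / m : ℕ) - (j.val / m : ℕ) - p * q := by
        rw [← hq]; simp only [x]; ring
      push_cast at hi hj hdx ⊢
      rw [hdx]
      linear_combination -hi + hj
    have h3 : g ((d : ℤ) * m + (i.val % m : ℕ) - (j.val % m : ℕ)) = g ((i.val : ℤ) - j.val) := by
      rw [h2]
      exact hg.sub_int_mul_eq q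
    change g _ = (p : ℂ)⁻¹ * g ((d : ℤ) * m + (i.val % m : ℕ) - (j.val % m : ℕ)) * (p : ℂ)
    have hpC : (p : ℂ) ≠ 0 := Nat.cast_ne_zero.2 hp.ne'
    rw [h3]
    field_simp
  · intro δ _ hδ
    rw [if_neg, mul_zero]
    intro h
    refine hδ (Fin.ext ?_)
    have h1 : x % p = (δ.val : ℤ) % p :=
      Int.emod_eq_emod_iff_emod_sub_eq_zero.2 (Int.emod_eq_zero_of_dvd h)
    have h2 : (δ.val : ℤ) % p = δ.val := Int.emod_eq_of_lt (by positivity) (by exact_mod_cast δ.2)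
    show δ.val = d
    omega
  · simp

theorem mem_mulStar_of_apply_eq {p m n : ℕ} (hn : n = p * m) {M : Mat n} {g : ℤ → ℂ}
    (hg : Function.Periodic g n) (a b : Fin n → ℂ)
    (hM : ∀ i j, M i j = a i * g ((i.val : ℤ) - j.val) * b j) :
    M ∈ mulStar (monarchBlock m n) := by
  have : M = diagonal a * differenceMatrix n g * diagonal b := by
    ext i j
    rw [hM, mul_diagonal, diagonal_mul]
    rfl
  rw [this]
  exact mul_diagonal_mem_mulStar
    (diagonal_mul_mem_mulStar (differenceMatrix_mem_mulStar hn hg) a) b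

theorem convolutions_subset {m : ℕ} (hm : 1 ≤ m) : convolutions (m * m) ⊆ MMstar m := by
  rintro _ ⟨h, rfl⟩
  rw [MMstar_eq]
  have hn : 0 < m * m := Nat.mul_pos hm hm
  have hn' : (0 : ℤ) < (m * m : ℕ) := by exact_mod_cast hn
  refine mem_mulStar_of_apply_eq (p := m) rfl
    (g := fun x => h ⟨(x % (m * m : ℕ)).toNat, by
      have := Int.emod_lt_of_pos x hn'
      have := Int.emod_nonneg x hn'.ne'
      omega⟩) (fun x => by simp) 1 1 fun i j => ?_
  rw [circulant_apply]
  simp only [Pi.one_apply, one_mul, mul_one]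
  congr 1
  refine Fin.ext ?_
  rw [Fin.sub_def]
  have h1 : ((i.val : ℤ) - j.val) % (m * m : ℕ) =
      ((m * m - j.val + i.val : ℕ) : ℤ) % (m * m : ℕ) := by
    rw [Nat.cast_add, Nat.cast_sub j.2.le, ← Int.add_emod_left]
    congr 1
    ring
  show _ = (((i.val : ℤ) - j.val) % (m * m : ℕ)).toNat
  rw [h1, ← Int.natCast_mod, Int.toNat_natCast]

/-- Differences of indices lie strictly between -n and n, so they stay distinct modulo 2n and the
matrix extends to a circulant of size 2n. -/
theorem toeplitz_subset {m : ℕ} (hm : 1 ≤ m) :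
    toeplitz (m * m) ⊆ MMstarExp m (m * m) 2 := by
  rintro T ⟨t, ht⟩
  have hn : 0 < m * m := Nat.mul_pos hm hm
  refine ⟨_, differenceMatrix_mem_mulStar (p := 2 * m) (by ring)
    -- Shifting by n before and after the reduction selects the representative in [-n, n).
    (g := fun x => t ((x + (m * m : ℕ)) % (2 * (m * m) : ℕ) - (m * m : ℕ))) fun x => ?_, ?_⟩
  · simp only [add_right_comm x, Int.add_emod_right]
  · ext i j
    rw [ht]
    simp only [differenceMatrix, submatrix_apply, Matrix.of_apply, Fin.val_castLE]
    rw [Int.emod_eq_of_lt]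
    · congr 1
      ring
    · have := j.2
      omega
    · have := i.2
      push_cast
      have h1 : (i.val : ℤ) < (m : ℤ) * m := by exact_mod_cast i.2
      linarith [Int.natCast_nonneg j.val]

/-! ### The discrete Fourier transform -/

theorem dft_apply_zpow (n : ℕ) (j k : Fin n) :
    dft n j k = Complex.exp (2 * Real.pi * Complex.I / n) ^ (-((j.val : ℤ) * k.val)) := by
  rw [← Complex.exp_int_mul, dft, Matrix.of_apply]
  congr 1
  push_cast
  ring

theorem dft_inv {n : ℕ} (hn : 0 < n) :
    (dft n)⁻¹ = Matrix.of fun j k : Fin n =>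
      (n : ℂ)⁻¹ * Complex.exp (2 * Real.pi * Complex.I / n) ^ ((j.val : ℤ) * k.val) := by
  have : NeZero n := ⟨hn.ne'⟩
  have hζ := Complex.isPrimitiveRoot_exp n hn.ne'
  refine Matrix.inv_eq_right_inv ?_
  ext j l
  have hterm : ∀ k : Fin n, dft n j k * (Matrix.of fun j k : Fin n =>
      (n : ℂ)⁻¹ * Complex.exp (2 * Real.pi * Complex.I / n) ^ ((j.val : ℤ) * k.val)) k l =
      (n : ℂ)⁻¹ * Complex.exp (2 * Real.pi * Complex.I / n) ^
        ((k.val : ℤ) * ((l.val : ℤ) - j.val)) := fun k => by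
    rw [dft_apply_zpow, Matrix.of_apply, mul_left_comm, ← zpow_add₀ (hζ.ne_zero hn.ne')]
    congr 2
    ring
  rw [Matrix.mul_apply, Finset.sum_congr rfl fun k _ => hterm k, ← Finset.mul_sum,
    sum_zpow_of_isPrimitiveRoot hζ, Matrix.one_apply]
  have hnC : (n : ℂ) ≠ 0 := Nat.cast_ne_zero.2 hn.ne'
  by_cases h : j = l
  · rw [if_pos h, if_pos (by simp [h]), inv_mul_cancel₀ hnC]
  · rw [if_neg h, if_neg, mul_zero]
    intro hd
    refine h (Fin.ext ?_)
    have h0 := Int.eq_zero_of_abs_lt_dvd hd (by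
      have := j.2
      have := l.2
      rw [abs_lt]
      constructor <;> omega)
    omega

/-- Conjugating a diagonal matrix by the DFT gives a circulant, whose symbol is the transform of the
diagonal. -/
theorem afdf_subset {m : ℕ} (hm : 1 ≤ m) : afdf (m * m) ⊆ MMstar m := by
  rintro _ ⟨a, d, rfl⟩
  have hn : 0 < m * m := Nat.mul_pos hm hm
  have hζ := Complex.isPrimitiveRoot_exp (m * m) hn.ne'
  rw [MMstar_eq, dft_inv hn]
  generalize hz : Complex.exp (2 * Real.pi * Complex.I / (m * m : ℕ)) = ζ at hζ
  have hζ0 : ζ ≠ 0 := hζ.ne_zero hn.ne'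
  refine mem_mulStar_of_apply_eq (p := m) rfl
    (g := fun x => ∑ q : Fin (m * m), d q * ((m * m : ℕ) : ℂ)⁻¹ * ζ ^ (-(x * (q.val : ℤ)))) ?_ a 1 ?_
  · intro x
    refine Finset.sum_congr rfl fun q _ => ?_
    congr 1
    have : -((x + ((m * m : ℕ) : ℤ)) * (q.val : ℤ)) =
        -(x * (q.val : ℤ)) + ((m * m : ℕ) : ℤ) * (-(q.val : ℤ)) := by ring
    rw [this, zpow_add₀ hζ0, _root_.zpow_mul, zpow_natCast, hζ.pow_eq_one, _root_.one_zpow, mul_one]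
  · intro i j
    rw [Matrix.mul_apply, Finset.mul_sum, Finset.sum_mul]
    refine Finset.sum_congr rfl fun q _ => ?_
    rw [mul_diagonal, diagonal_mul, dft_apply_zpow, hz, Matrix.of_apply]
    have : -(((i.val : ℤ) - j.val) * (q.val : ℤ)) =
        -((i.val : ℤ) * q.val) + (q.val : ℤ) * j.val := by ring
    rw [this, zpow_add₀ hζ0, Pi.one_apply]
    ring

/-- The chirp `exp(πi (x² / n + x))`, an `n`-periodic function of the integer `x`. -/
noncomputable def chirp (n : ℕ) (x : ℤ) : ℂ :=
  Complex.exp (Real.pi * Complex.I * ((x : ℂ) ^ 2 / n + x))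

/-- The quadratic term alone changes by 2x + n, which is odd for odd n; the linear term adds another
n, and the change becomes the even integer 2(x + n). -/
theorem chirp_periodic {n : ℕ} (hn : 0 < n) : Function.Periodic (chirp n) n := by
  intro x
  have hnC : (n : ℂ) ≠ 0 := Nat.cast_ne_zero.2 hn.ne'
  refine Complex.exp_eq_exp_iff_exists_int.2 ⟨x + n, ?_⟩
  push_cast
  field_simp
  ring

/-- The chirp transform: the DFT kernel is a diagonally scaled circulant. -/
theorem exp_eq_chirp {n : ℕ} (hn : 0 < n) (k j : ℕ) :
    Complex.exp (-(2 * Real.pi * Complex.I * (k : ℂ) * (j : ℂ) / (n : ℂ))) =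
      Complex.exp (-(Real.pi * Complex.I * ((k : ℂ) ^ 2 / n + k))) * chirp n ((k : ℤ) - j) *
        Complex.exp (-(Real.pi * Complex.I * ((j : ℂ) ^ 2 / n - j))) := by
  have hnC : (n : ℂ) ≠ 0 := Nat.cast_ne_zero.2 hn.ne'
  rw [chirp, ← Complex.exp_add, ← Complex.exp_add]
  congr 1
  push_cast
  field_simp
  ring

theorem dft_mem_mulStar {p m n : ℕ} (hn : n = p * m) :
    dft n ∈ mulStar (monarchBlock m n) := by
  rcases Nat.eq_zero_or_pos n with h0 | hpos
  · subst h0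
    exact mem_mulStar_of_apply_eq hn (g := 0) (fun _ => rfl) 0 0 fun i => i.elim0
  · exact mem_mulStar_of_apply_eq hn (chirp_periodic hpos) _ _ fun i j =>
      exp_eq_chirp hpos i.val j.val

theorem dft_mem_MMstarSq (m : ℕ) : dft (m * m) ∈ MMstarSq m := by
  rw [MMstarSq_eq]
  exact ⟨_, dft_mem_mulStar rfl, 1, one_mem_mulStar, (Matrix.mul_one _).symm⟩

/-! ### Cosine and sine transforms as real parts -/

/-- The sign with which the angle of the `q`-th sample enters the FFT algorithm for the DCT. -/
def evenOddSign (q : ℕ) : ℝ := if q % 2 = 0 then -1 else 1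

theorem evenOdd_lt {n q : ℕ} (hq : q < n) : (if q % 2 = 0 then q / 2 else n - 1 - q / 2) < n := by
  split_ifs <;> omega

/-- The permutation `2j ↦ j`, `2j + 1 ↦ n - 1 - j`: samples with an even index come first, followed
by those with an odd index in reversed order. -/
noncomputable def evenOddPerm (n : ℕ) : Equiv.Perm (Fin n) :=
  Equiv.ofBijective (fun q => ⟨if q.val % 2 = 0 then q.val / 2 else n - 1 - q.val / 2,
    evenOdd_lt q.2⟩) <| Finite.injective_iff_bijective.1 fun q r h => by
      have h1 := q.2
      have h2 := r.2
      have h3 : (if q.val % 2 = 0 then q.val / 2 else n - 1 - q.val / 2) =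
        if r.val % 2 = 0 then r.val / 2 else n - 1 - r.val / 2 := Fin.ext_iff.1 h
      refine Fin.ext ?_
      split_ifs at h3 <;> omega

/-- The angle `π (2q + 1) k / (2n)` of the type-II transforms. -/
noncomputable def angle (n k q : ℕ) : ℝ :=
  Real.pi * (2 * (q : ℝ) + 1) * (k : ℝ) / (2 * n)

/-- For q = 2j and for q = 2n - 1 - 2j the signed angle is -π(4j + 1)k/(2n), up to k full turns in
the odd case. The 4j gives the DFT entry and the 1 a phase of the row. -/
theorem exp_angle_eq_dft {n : ℕ} (k q : Fin n) :
    Complex.exp ((evenOddSign q.val * angle n k.val q.val : ℝ) * Complex.I) =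
      Complex.exp (-(Real.pi * Complex.I * k.val / (2 * n))) * dft n k (evenOddPerm n q) := by
  have hn : 0 < n := Fin.pos k
  have hnC : (n : ℂ) ≠ 0 := Nat.cast_ne_zero.2 hn.ne'
  rw [dft, Matrix.of_apply, ← Complex.exp_add]
  by_cases h : q.val % 2 = 0
  · have hq : q.val = 2 * (evenOddPerm n q).val := by
      simp only [evenOddPerm, Equiv.ofBijective_apply, h, if_true]
      omega
    have hq' : (q.val : ℂ) = 2 * ((evenOddPerm n q).val : ℂ) := by exact_mod_cast hq
    congr 1
    simp only [evenOddSign, angle, h, if_true]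
    push_cast
    rw [hq']
    field_simp
    ring
  · have hq : q.val + 2 * (evenOddPerm n q).val + 1 = 2 * n := by
      simp only [evenOddPerm, Equiv.ofBijective_apply, h, if_false]
      omega
    have hq' : (q.val : ℂ) = 2 * n - 1 - 2 * ((evenOddPerm n q).val : ℂ) := by
      rw [← show ((q.val + 2 * (evenOddPerm n q).val + 1 : ℕ) : ℂ) = 2 * n by rw [hq]; push_cast; rfl]
      push_cast
      ring
    refine Complex.exp_eq_exp_iff_exists_int.2 ⟨k.val, ?_⟩
    simp only [evenOddSign, angle, h, if_false]
    push_cast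
    rw [hq']
    field_simp
    ring

theorem scaled_exp_angle_mem_MMstarSq (m : ℕ) (a b : Fin (m * m) → ℂ) :
    (Matrix.of fun k q : Fin (m * m) => a k *
      Complex.exp ((evenOddSign q.val * angle (m * m) k.val q.val : ℝ) * Complex.I) * b q)
        ∈ MMstarSq m := by
  rw [MMstarSq_eq]
  refine ⟨_, diagonal_mul_mem_mulStar (dft_mem_mulStar rfl)
    (fun k => a k * Complex.exp (-(Real.pi * Complex.I * k.val / (2 * (m * m : ℕ))))), _,
    mul_diagonal_mem_mulStar (permMatrix_mem_mulStar (evenOddPerm (m * m))⁻¹) b, ?_⟩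
  ext k q
  rw [← Matrix.mul_assoc, mul_diagonal, Matrix.mul_apply,
    Finset.sum_eq_single (evenOddPerm (m * m) q)]
  · rw [diagonal_mul, Matrix.of_apply, exp_angle_eq_dft]
    simp only [Equiv.Perm.permMatrix, PEquiv.toMatrix_apply, Equiv.toPEquiv_apply, Equiv.Perm.inv_def,
      Equiv.symm_apply_apply, Option.mem_some_iff, if_true]
    ring
  · intro j _ hj
    have : (evenOddPerm (m * m)).symm j ≠ q := fun h => hj (by rw [← h, Equiv.apply_symm_apply])
    simp [Equiv.Perm.permMatrix, PEquiv.toMatrix_apply, Equiv.Perm.inv_def, this]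
  · simp

theorem evenOddSign_cases (q : ℕ) : evenOddSign q = -1 ∨ evenOddSign q = 1 := by
  unfold evenOddSign
  split_ifs
  · exact Or.inl rfl
  · exact Or.inr rfl

theorem exists_re_eq_dct (m : ℕ) : ∃ M ∈ MMstarSq m, M.map Complex.re = dct (m * m) := by
  refine ⟨_, scaled_exp_angle_mem_MMstarSq m
    (fun k => (Real.sqrt ((if k.val = 0 then 1 else 2) / ((m * m : ℕ) : ℝ)) : ℂ)) 1, ?_⟩
  ext k q
  simp only [Matrix.map_apply, Matrix.of_apply, Pi.one_apply, mul_one]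
  rw [Complex.re_ofReal_mul, Complex.exp_ofReal_mul_I_re, dct, Matrix.of_apply, ← angle]
  rcases evenOddSign_cases q.val with h | h <;> simp [h]

theorem exists_re_eq_dst (m : ℕ) : ∃ M ∈ MMstarSq m, M.map Complex.re = dst (m * m) := by
  refine ⟨_, scaled_exp_angle_mem_MMstarSq m
    (fun k => (Real.sqrt ((if k.val + 1 = m * m then 1 else 2) / ((m * m : ℕ) : ℝ)) : ℂ))
    -- The first column factor raises the frequency from k to k + 1. With ε the sign, the second
    -- turns the real part into ε sin(εθ) = sin θ.
    (fun q => Complex.exp ((evenOddSign q.val * angle (m * m) 1 q.val : ℝ) * Complex.I) *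
      (-(evenOddSign q.val : ℂ) * Complex.I)), ?_⟩
  ext k q
  simp only [Matrix.map_apply, Matrix.of_apply]
  have h1 : evenOddSign q.val * angle (m * m) k.val q.val + evenOddSign q.val * angle (m * m) 1 q.val
      = evenOddSign q.val * angle (m * m) (k.val + 1) q.val := by
    simp only [angle]
    push_cast
    ring
  rw [mul_assoc, ← mul_assoc (Complex.exp _) (Complex.exp _), ← Complex.exp_add, ← add_mul,
    ← Complex.ofReal_add, h1, Complex.re_ofReal_mul, dst, Matrix.of_apply]
  have h2 : Real.pi * (2 * (q.val : ℝ) + 1) * ((k.val : ℝ) + 1) / (2 * (m * m : ℕ)) =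
      angle (m * m) (k.val + 1) q.val := by
    simp only [angle]
    push_cast
    ring
  rw [h2]
  congr 1
  rw [Complex.mul_re, Complex.exp_ofReal_mul_I_re, Complex.exp_ofReal_mul_I_im]
  rcases evenOddSign_cases q.val with h | h <;> simp [h]

/-! ### Reflections followed by a circulant, with expansion two -/

/-- A permutation of `{0, …, 2m² - 1}` within the rows of length `m`, which reflects the rows of the
second half. -/
def rowReflection (m s j : ℕ) : ℕ :=
  if j < m * m then j else m * (j / m) + (2 * m - s - j % m) % m

/-- The point in the column of `l` and in the row of the reflected index `2m² - s - l`. -/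
def reflectedRow (m s l : ℕ) : ℕ := m * ((2 * (m * m) - s - l) / m) + l % m

theorem rowReflection_div {m : ℕ} (hm : 1 ≤ m) (s j : ℕ) : rowReflection m s j / m = j / m := by
  unfold rowReflection
  split_ifs
  · rfl
  · rw [Nat.mul_add_div hm, Nat.div_eq_of_lt (Nat.mod_lt _ hm), Nat.add_zero]

theorem rowReflection_lt {m s j : ℕ} (hm : 1 ≤ m) (hj : j < 2 * (m * m)) :
    rowReflection m s j < 2 * (m * m) := by
  have h : j / m < 2 * m := by
    rw [Nat.div_lt_iff_lt_mul hm]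
    linarith
  rw [← rowReflection_div hm s j, Nat.div_lt_iff_lt_mul hm] at h
  linarith

theorem reflectedRow_div {m : ℕ} (hm : 1 ≤ m) (s l : ℕ) :
    reflectedRow m s l / m = (2 * (m * m) - s - l) / m := by
  rw [reflectedRow, Nat.mul_add_div hm, Nat.div_eq_of_lt (Nat.mod_lt _ hm), Nat.add_zero]

theorem reflectedRow_mod (m s l : ℕ) : reflectedRow m s l % m = l % m := by
  rw [reflectedRow, Nat.mul_add_mod, Nat.mod_mod]

theorem reflectedRow_lt {m s l : ℕ} (hm : 1 ≤ m) (hsl : s + l ≠ 0) :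
    reflectedRow m s l < 2 * (m * m) := by
  have h : (2 * (m * m) - s - l) / m < 2 * m := by
    rw [Nat.div_lt_iff_lt_mul hm]
    have := Nat.mul_pos hm hm
    have : 2 * m * m = 2 * (m * m) := by ring
    omega
  rw [← reflectedRow_div hm s l, Nat.div_lt_iff_lt_mul hm] at h
  linarith

/-- This factors the reflection l ↦ 2m² - s - l: first a move to the right block with the residue
kept, then a correction inside that block. The images lie in the second half, so the correction can
leave the first half fixed. -/
theorem rowReflection_reflectedRow {m s l : ℕ} (hm : 1 ≤ m) (hs : s ≤ 1) (hl : l < m * m) :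
    rowReflection m s (reflectedRow m s l) = 2 * (m * m) - s - l := by
  have hge : m * m ≤ reflectedRow m s l := by
    rw [← Nat.le_div_iff_mul_le hm, reflectedRow_div hm, Nat.le_div_iff_mul_le hm]
    omega
  rw [rowReflection, if_neg (by omega), reflectedRow_div hm, reflectedRow_mod]
  have hq : l / m < m := (Nat.div_lt_iff_lt_mul hm).2 hl
  have hc : l % m < m := Nat.mod_lt _ hm
  have hdm := Nat.div_add_mod l m
  -- Borrowing two blocks of length `m` separates the residue from the quotient without truncated
  -- subtraction.
  obtain ⟨B, hB⟩ : ∃ B, B + 2 + l / m = 2 * m := ⟨2 * m - 2 - l / m, by omega⟩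
  have hmB : m * B + 2 * m + m * (l / m) = 2 * (m * m) := by
    calc m * B + 2 * m + m * (l / m) = m * (B + 2 + l / m) := by ring
      _ = 2 * (m * m) := by rw [hB]; ring
  have hφ : 2 * (m * m) - s - l = (2 * m - s - l % m) + m * B := by omega
  have hmod : (2 * m - s - l % m) % m = (2 * (m * m) - s - l) % m := by
    rw [hφ, Nat.add_mul_mod_self_left]
  rw [hmod, Nat.div_add_mod]

/-- A scaled circulant of size 2n is multiplied by a matrix whose column l has `u l` at l and `v l`
at 2n - s - l; periodicity turns g(k - (2n - s - l)) into g(k + l + s). The condition `hv` concerns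
s = l = 0, where the reflected index 2n falls outside the matrix. -/
theorem reflection_mem_MMstarSqExp {m : ℕ} {g : ℤ → ℂ} (hm : 1 ≤ m)
    (hg : Function.Periodic g (2 * (m * m) : ℕ)) {s : ℕ} (hs : s ≤ 1) (a u v : Fin (m * m) → ℂ)
    (hv : ∀ l : Fin (m * m), s + l.val = 0 → v l = 0) {M : Mat (m * m)}
    (hM : ∀ k l, M k l = a k * (u l * g ((k.val : ℤ) - l.val) +
      v l * g ((k.val : ℤ) + l.val + s))) :
    M ∈ MMstarSqExp m (m * m) 2 := by
  let ext : (Fin (m * m) → ℂ) → Fin (2 * (m * m)) → ℂ := fun w k =>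
    if h : k.val < m * m then w ⟨k.val, h⟩ else 0
  let D : Mat (2 * (m * m)) := diagonal (ext a) * differenceMatrix (2 * (m * m)) g
  let R : Mat (2 * (m * m)) := Matrix.of fun i j =>
    if i.val = rowReflection m s j.val then 1 else 0
  let L : Mat (2 * (m * m)) := Matrix.of fun j l =>
    (if j = l then ext u l else 0) + if j.val = reflectedRow m s l.val then ext v l else 0
  have hR : R ∈ blockDiagonals m (2 * (m * m)) := fun i j h =>
    if_neg fun e => h (by rw [e, rowReflection_div hm])
  have hL : L ∈ diagBlocks m (2 * (m * m)) := fun j l h => by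
    have h1 : j ≠ l := fun e => h (by rw [e])
    have h2 : j.val ≠ reflectedRow m s l.val := fun e => h (by rw [e, reflectedRow_mod])
    simp only [L, Matrix.of_apply, h1, h2, if_false, add_zero]
  refine ⟨_, ⟨D, diagonal_mul_mem_mulStar
    (differenceMatrix_mem_mulStar (p := 2 * m) (by ring) hg) _, R * L, mul_mem_mulStar hR hL, rfl⟩, ?_⟩
  have hDR : ∀ k j, (D * R) k j =
      ext a k * g ((k.val : ℤ) - (rowReflection m s j.val : ℕ)) := fun k j => by
    rw [Matrix.mul_apply, Finset.sum_eq_single ⟨rowReflection m s j.val, rowReflection_lt hm j.2⟩]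
    · simp only [D, R, diagonal_mul, Matrix.of_apply, if_true, mul_one, differenceMatrix]
    · intro i _ hi
      simp only [R, Matrix.of_apply]
      rw [if_neg fun e => hi (Fin.ext e), mul_zero]
    · simp
  ext k l
  rw [submatrix_apply, ← Matrix.mul_assoc, Matrix.mul_apply]
  set k' : Fin (2 * (m * m)) := Fin.castLE _ k with hk'
  set l' : Fin (2 * (m * m)) := Fin.castLE _ l with hl'
  have hext : ∀ (w : Fin (m * m) → ℂ) (i : Fin (m * m)) h, ext w (Fin.castLE h i) = w i :=
    fun w i h => dif_pos i.2
  simp only [hDR, L, Matrix.of_apply, mul_add, Finset.sum_add_distrib]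
  rw [Finset.sum_eq_single l' (fun j _ hj => by rw [if_neg hj, mul_zero]) (by simp), if_pos rfl,
    hM, mul_add]
  have hkv : k'.val = k.val := rfl
  have hlv : l'.val = l.val := rfl
  rw [hk', hl', hext, hext, hext, ← hk', ← hl', hkv, hlv]
  congr 1
  · rw [rowReflection, if_pos l.2]
    ring
  · by_cases h0 : s + l.val = 0
    · simp [hv l h0]
    · rw [Finset.sum_eq_single ⟨reflectedRow m s l.val, reflectedRow_lt hm h0⟩
        (fun j _ hj => by rw [if_neg fun e => hj (Fin.ext e), mul_zero]) (by simp), if_pos rfl,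
        rowReflection_reflectedRow hm hs l.2]
      have : (k.val : ℤ) - ((2 * (m * m) - s - l.val : ℕ) : ℤ) =
          (k.val : ℤ) + l.val + s - ((2 * (m * m) : ℕ) : ℤ) := by
        have := l.2
        omega
      rw [this, hg.sub_eq]
      ring

/-! ### Cosine and sine transforms with expansion two -/

/-- From -(2q+1)k = (k-q)² - k² - k - q². The companion for the opposite sign uses (2q+1)k =
(k+q+1)² - k² - k - (q+1)², with the same row factor, so the two exponentials can be combined. -/
theorem exp_neg_angle_eq_chirp {n : ℕ} (hn : 0 < n) (k q : ℕ) :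
    Complex.exp (-(angle n k q * Complex.I)) =
      Complex.exp (-(Real.pi * Complex.I * (k / (2 * n) + (k : ℂ) ^ 2 / (2 * n) + k))) *
        chirp (2 * n) ((k : ℤ) - q) *
        Complex.exp (-(Real.pi * Complex.I * ((q : ℂ) ^ 2 / (2 * n) - q))) := by
  have hnC : (n : ℂ) ≠ 0 := Nat.cast_ne_zero.2 hn.ne'
  rw [chirp, ← Complex.exp_add, ← Complex.exp_add, angle]
  congr 1
  push_cast
  field_simp
  ring

theorem exp_angle_eq_chirp {n : ℕ} (hn : 0 < n) (k q : ℕ) :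
    Complex.exp (angle n k q * Complex.I) =
      Complex.exp (-(Real.pi * Complex.I * (k / (2 * n) + (k : ℂ) ^ 2 / (2 * n) + k))) *
        chirp (2 * n) ((k : ℤ) + q + (1 : ℕ)) *
        Complex.exp (-(Real.pi * Complex.I * (((q : ℂ) + 1) ^ 2 / (2 * n) + (q + 1)))) := by
  have hnC : (n : ℂ) ≠ 0 := Nat.cast_ne_zero.2 hn.ne'
  rw [chirp, ← Complex.exp_add, ← Complex.exp_add, angle]
  congr 1
  push_cast
  field_simp
  ring

theorem combined_exp_angle_mem_MMstarSqExp {m : ℕ} (hm : 1 ≤ m) (a u v : Fin (m * m) → ℂ)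
    {M : Mat (m * m)}
    (hM : ∀ k q, M k q = a k * (u q * Complex.exp (-(angle (m * m) k.val q.val * Complex.I)) +
      v q * Complex.exp (angle (m * m) k.val q.val * Complex.I))) :
    M ∈ MMstarSqExp m (m * m) 2 := by
  have hn : 0 < m * m := Nat.mul_pos hm hm
  refine reflection_mem_MMstarSqExp (s := 1) hm
    (chirp_periodic (n := 2 * (m * m)) (by omega)) le_rfl
    (fun k => a k * Complex.exp (-(Real.pi * Complex.I *
      (k.val / (2 * (m * m : ℕ)) + (k.val : ℂ) ^ 2 / (2 * (m * m : ℕ)) + k.val))))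
    (fun q => u q * Complex.exp (-(Real.pi * Complex.I *
      ((q.val : ℂ) ^ 2 / (2 * (m * m : ℕ)) - q.val))))
    (fun q => v q * Complex.exp (-(Real.pi * Complex.I *
      (((q.val : ℂ) + 1) ^ 2 / (2 * (m * m : ℕ)) + (q.val + 1)))))
    (fun l h => absurd h (by omega)) fun k q => ?_
  rw [hM, exp_neg_angle_eq_chirp hn, exp_angle_eq_chirp hn]
  ring

theorem dct_mem_MMstarSqExp {m : ℕ} (hm : 1 ≤ m) :
    toC (dct (m * m)) ∈ MMstarSqExp m (m * m) 2 := by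
  refine combined_exp_angle_mem_MMstarSqExp hm
    (fun k => (Real.sqrt ((if k.val = 0 then 1 else 2) / ((m * m : ℕ) : ℝ)) : ℂ))
    (fun _ => 1 / 2) (fun _ => 1 / 2) fun k q => ?_
  rw [toC, Matrix.map_apply, dct, Matrix.of_apply, ← angle, Complex.ofReal_mul, Complex.ofReal_cos,
    Complex.cos, ← neg_mul]
  ring

/-- The angle at frequency k + 1 exceeds that at k by an amount independent of k, which goes into
the column weights. -/
theorem dst_mem_MMstarSqExp {m : ℕ} (hm : 1 ≤ m) :
    toC (dst (m * m)) ∈ MMstarSqExp m (m * m) 2 := by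
  refine combined_exp_angle_mem_MMstarSqExp hm
    (fun k => (Real.sqrt ((if k.val + 1 = m * m then 1 else 2) / ((m * m : ℕ) : ℝ)) : ℂ))
    (fun q => Complex.I / 2 * Complex.exp (-(angle (m * m) 1 q.val * Complex.I)))
    (fun q => -Complex.I / 2 * Complex.exp (angle (m * m) 1 q.val * Complex.I)) fun k q => ?_
  have h : Real.pi * (2 * (q.val : ℝ) + 1) * ((k.val : ℝ) + 1) / (2 * (m * m : ℕ)) =
      angle (m * m) 1 q.val + angle (m * m) k.val q.val := by
    simp only [angle]
    push_cast
    ring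
  rw [toC, Matrix.map_apply, dst, Matrix.of_apply, h, Complex.ofReal_mul, Complex.ofReal_sin,
    Complex.sin, Complex.ofReal_add, mul_assoc (Complex.I / 2), mul_assoc (-Complex.I / 2),
    ← Complex.exp_add, ← Complex.exp_add, ← add_mul, ← neg_add, ← add_mul, ← neg_mul]
  ring

/-! ### The orthogonality of the DCT -/

/-- Multiplication by 2 sin(πx/(2n)), nonzero in this range of x, makes the sum telescope to sin(πx)
= 0. -/
theorem sum_cos_odd_mul {n : ℕ} (hn : 0 < n) {x : ℤ} (hx : x ≠ 0) (hlt : |x| < 2 * n) :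
    ∑ q : Fin n, Real.cos (Real.pi * (2 * (q.val : ℝ) + 1) * x / (2 * n)) = 0 := by
  have hnR : (n : ℝ) ≠ 0 := Nat.cast_ne_zero.2 hn.ne'
  have hsin : Real.sin (Real.pi * x / (2 * n)) ≠ 0 := by
    intro h
    obtain ⟨k, hk⟩ := Real.sin_eq_zero_iff.1 h
    have hk' : (k : ℝ) * (2 * n) = x := by
      field_simp at hk
      linarith
    have hk'' : x = 2 * n * k := by
      have : k * (2 * n) = x := by exact_mod_cast hk'
      linarith
    exact hx (Int.eq_zero_of_abs_lt_dvd ⟨k, hk''⟩ hlt)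
  have htel : ∀ q : ℕ, 2 * Real.sin (Real.pi * x / (2 * n)) *
      Real.cos (Real.pi * (2 * (q : ℝ) + 1) * x / (2 * n)) =
      Real.sin (Real.pi * x / n * ((q + 1 : ℕ) : ℝ)) - Real.sin (Real.pi * x / n * (q : ℝ)) := by
    intro q
    rw [Real.sin_sub_sin]
    congr 2
    · congr 1
      push_cast
      field_simp
      ring
    · push_cast
      field_simp
      ring
  have hsum : 2 * Real.sin (Real.pi * x / (2 * n)) *
      ∑ q : Fin n, Real.cos (Real.pi * (2 * (q.val : ℝ) + 1) * x / (2 * n)) = 0 := by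
    rw [Finset.mul_sum, Finset.sum_congr rfl fun q _ => htel q.val,
      ← Finset.sum_range fun q : ℕ => Real.sin (Real.pi * x / n * ((q + 1 : ℕ) : ℝ)) -
        Real.sin (Real.pi * x / n * (q : ℝ)),
      Finset.sum_range_sub fun q : ℕ => Real.sin (Real.pi * x / n * (q : ℝ))]
    have : Real.pi * x / n * (n : ℝ) = x * Real.pi := by
      field_simp
    rw [this, Real.sin_int_mul_pi]
    simp
  exact (mul_eq_zero.1 hsum).resolve_left (mul_ne_zero two_ne_zero hsin)

theorem dct_apply_mul (n : ℕ) (k l q : Fin n) :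
    dct n k q * dct n l q =
      Real.sqrt ((if k.val = 0 then 1 else 2) / (n : ℝ)) *
        Real.sqrt ((if l.val = 0 then 1 else 2) / (n : ℝ)) / 2 *
        (Real.cos (Real.pi * (2 * (q.val : ℝ) + 1) * ((k.val - l.val : ℤ) : ℝ) / (2 * n)) +
          Real.cos (Real.pi * (2 * (q.val : ℝ) + 1) * ((k.val + l.val : ℤ) : ℝ) / (2 * n))) := by
  have h1 : Real.pi * (2 * (q.val : ℝ) + 1) * ((k.val - l.val : ℤ) : ℝ) / (2 * n) =
      angle n k.val q.val - angle n l.val q.val := by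
    simp only [angle]
    push_cast
    ring
  have h2 : Real.pi * (2 * (q.val : ℝ) + 1) * ((k.val + l.val : ℤ) : ℝ) / (2 * n) =
      angle n k.val q.val + angle n l.val q.val := by
    simp only [angle]
    push_cast
    ring
  rw [h1, h2, Real.cos_sub, Real.cos_add, dct, Matrix.of_apply, Matrix.of_apply, ← angle, ← angle]
  ring

theorem dct_mul_transpose {n : ℕ} (hn : 0 < n) : dct n * (dct n)ᵀ = 1 := by
  have hnR : (n : ℝ) ≠ 0 := Nat.cast_ne_zero.2 hn.ne'
  ext k l
  have hk := k.2
  have hl := l.2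
  simp only [Matrix.mul_apply, Matrix.transpose_apply, dct_apply_mul]
  rw [← Finset.mul_sum, Finset.sum_add_distrib, Matrix.one_apply]
  by_cases h : k = l
  · subst h
    rw [if_pos rfl, Real.mul_self_sqrt (by split_ifs <;> positivity)]
    by_cases h0 : k.val = 0
    · simp only [h0, if_true, Nat.cast_zero, sub_self, add_zero, Int.cast_zero, mul_zero, zero_div,
        Real.cos_zero, Finset.sum_const, Finset.card_univ, Fintype.card_fin, nsmul_eq_mul, mul_one]
      field_simp
      ring
    · rw [sum_cos_odd_mul hn (x := k.val + k.val) (by omega) (by rw [abs_lt]; constructor <;> omega)]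
      simp only [h0, if_false, sub_self, Int.cast_zero, mul_zero, zero_div, add_zero,
        Real.cos_zero, Finset.sum_const, Finset.card_univ, Fintype.card_fin, nsmul_eq_mul, mul_one]
      field_simp
  · have h' : k.val ≠ l.val := fun e => h (Fin.ext e)
    rw [if_neg h, sum_cos_odd_mul hn (by omega) (by rw [abs_lt]; constructor <;> omega),
      sum_cos_odd_mul hn (by omega) (by rw [abs_lt]; constructor <;> omega), add_zero, mul_zero]

theorem toC_mul {n : ℕ} (A B : Matrix (Fin n) (Fin n) ℝ) : toC A * toC B = toC (A * B) :=
  (Matrix.map_mul (f := Complex.ofRealHom)).symm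

theorem toC_one {n : ℕ} : toC (1 : Matrix (Fin n) (Fin n) ℝ) = 1 := by
  ext i j
  simp [toC, Matrix.one_apply, apply_ite Complex.ofReal]

theorem toC_dct_inv {n : ℕ} (hn : 0 < n) : (toC (dct n))⁻¹ = toC (dct n)ᵀ :=
  Matrix.inv_eq_right_inv (by rw [toC_mul, dct_mul_transpose hn, toC_one])

theorem toC_dct_transpose_inv {n : ℕ} (hn : 0 < n) : (toC (dct n)ᵀ)⁻¹ = toC (dct n) :=
  Matrix.inv_eq_left_inv (by rw [toC_mul, dct_mul_transpose hn, toC_one])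

/-! ### ACDC matrices -/

/-- By the product formula for cosines, C D Cᵀ has entries w_k w_l (c(k-l) + c(k+l)). Here c changes
sign under x ↦ x + 2n, since its frequencies are odd; the twist by `e (-x)`, which also changes
sign, restores periodicity, and its phases split into row and column factors. -/
theorem diagTransform_dct_subset {m : ℕ} (hm : 1 ≤ m) :
    diagTransform (toC (dct (m * m))) ⊆ MMstarSqExp m (m * m) 2 := by
  rintro _ ⟨a, d, rfl⟩
  have hn : 0 < m * m := Nat.mul_pos hm hm
  rw [toC_dct_inv hn]
  have hnR : ((m * m : ℕ) : ℝ) ≠ 0 := Nat.cast_ne_zero.2 hn.ne'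
  have hnC : ((m * m : ℕ) : ℂ) ≠ 0 := Nat.cast_ne_zero.2 hn.ne'
  let w : Fin (m * m) → ℝ := fun k => Real.sqrt ((if k.val = 0 then 1 else 2) / ((m * m : ℕ) : ℝ))
  let e : ℤ → ℂ := fun x => Complex.exp (Real.pi * Complex.I * x / (2 * (m * m : ℕ)))
  have he : ∀ x y, e (x + y) = e x * e y := fun x y => by
    simp only [e]
    rw [← Complex.exp_add]
    congr 1
    push_cast
    ring
  have he0 : e 0 = 1 := by simp [e]
  have hneg : ∀ x, e x * e (-x) = 1 := fun x => by rw [← he, add_neg_cancel, he0]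
  have hen : e (-(2 * (m * m) : ℕ)) = -1 := by
    rw [← Complex.exp_neg_pi_mul_I]
    simp only [e]
    congr 1
    rw [Nat.cast_mul 2 (m * m), Int.cast_neg, Int.cast_mul, Int.cast_natCast, Int.cast_natCast]
    field_simp
    norm_num
  let c : ℤ → ℂ := fun x => ∑ q : Fin (m * m), d q / 2 *
    ((Real.cos (Real.pi * (2 * (q.val : ℝ) + 1) * x / (2 * (m * m : ℕ))) : ℝ) : ℂ)
  have hc : ∀ x, c (x + (2 * (m * m) : ℕ)) = -c x := fun x => by
    simp only [c]
    rw [← Finset.sum_neg_distrib]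
    refine Finset.sum_congr rfl fun q _ => ?_
    have : Real.pi * (2 * (q.val : ℝ) + 1) * ((x + ((2 * (m * m) : ℕ) : ℤ) : ℤ) : ℝ) /
        (2 * (m * m : ℕ)) =
        Real.pi * (2 * (q.val : ℝ) + 1) * x / (2 * (m * m : ℕ)) + Real.pi +
          q.val * (2 * Real.pi) := by
      rw [Nat.cast_mul 2 (m * m), Int.cast_add, Int.cast_mul, Int.cast_natCast, Int.cast_natCast]
      field_simp
      push_cast
      ring
    rw [this, Real.cos_add_nat_mul_two_pi, Real.cos_add_pi]
    push_cast
    ring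
  have hg : Function.Periodic (fun x => e (-x) * c x) (2 * (m * m) : ℕ) := fun x => by
    simp only []
    rw [hc, neg_add, he, hen]
    ring
  refine reflection_mem_MMstarSqExp (s := 0) hm hg zero_le_one (fun k => a k * w k * e k.val)
    -- Column 0 has no reflected index within range; there c(k-l) = c(k+l), so the unreflected term
    -- is doubled instead.
    (fun l => (if l.val = 0 then 2 else 1) * w l * e (-l.val))
    (fun l => if l.val = 0 then 0 else w l * e l.val)
    (fun l h => if_pos (by omega)) fun k l => ?_
  have hM : (diagonal a * toC (dct (m * m)) * diagonal d * toC (dct (m * m))ᵀ) k l =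
      a k * w k * w l * (c (k.val - l.val) + c (k.val + l.val)) := by
    rw [Matrix.mul_apply]
    simp only [c]
    rw [← Finset.sum_add_distrib, Finset.mul_sum]
    refine Finset.sum_congr rfl fun q _ => ?_
    rw [mul_diagonal, diagonal_mul]
    have := congrArg Complex.ofReal (dct_apply_mul (m * m) k l q)
    rw [Complex.ofReal_mul] at this
    simp only [toC, Matrix.map_apply, transpose_apply]
    calc _ = a k * d q * ((dct (m * m) k q : ℂ) * (dct (m * m) l q : ℂ)) := by ring
      _ = _ := by
        rw [this, Complex.ofReal_mul, Complex.ofReal_div, Complex.ofReal_mul, Complex.ofReal_add]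
        simp only [w]
        push_cast
        ring
  have h1 : e k.val * e (-l.val) * e (-((k.val : ℤ) - l.val)) = 1 := by
    rw [← he, ← he, ← he0]
    congr 1
    ring
  have h2 : e k.val * e l.val * e (-((k.val : ℤ) + l.val + (0 : ℕ))) = 1 := by
    rw [← he, ← he, ← he0]
    congr 1
    push_cast
    ring
  rw [hM]
  simp only [Nat.cast_zero, add_zero] at h2 ⊢
  split_ifs with h0
  · rw [h0] at h1 ⊢
    simp only [Nat.cast_zero, sub_zero, add_zero] at h1 ⊢
    linear_combination (-(2 * a k * w k * w l * c k.val)) * h1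
  · linear_combination (-(a k * w k * w l * c (k.val - l.val))) * h1 -
      a k * w k * w l * c (k.val + l.val) * h2

/-- The angles now combine to πk(q-r)/n and πk(q+r+1)/n, whence s = 1; these cosines already have
period 2n, so no twist is needed. -/
theorem diagTransform_dct_transpose_subset {m : ℕ} (hm : 1 ≤ m) :
    diagTransform (toC (dct (m * m))ᵀ) ⊆ MMstarSqExp m (m * m) 2 := by
  rintro _ ⟨a, d, rfl⟩
  have hn : 0 < m * m := Nat.mul_pos hm hm
  have hnR : ((m * m : ℕ) : ℝ) ≠ 0 := Nat.cast_ne_zero.2 hn.ne'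
  rw [toC_dct_transpose_inv hn]
  let w : Fin (m * m) → ℝ := fun k => Real.sqrt ((if k.val = 0 then 1 else 2) / ((m * m : ℕ) : ℝ))
  let g : ℤ → ℂ := fun x => ∑ k : Fin (m * m), d k * (w k : ℂ) ^ 2 / 2 *
    ((Real.cos (Real.pi * k.val * x / (m * m : ℕ)) : ℝ) : ℂ)
  have hg : Function.Periodic g (2 * (m * m) : ℕ) := by
    intro x
    refine Finset.sum_congr rfl fun k _ => ?_
    congr 2
    have : Real.pi * k.val * ((x + ((2 * (m * m) : ℕ) : ℤ) : ℤ) : ℝ) / (m * m : ℕ) =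
        Real.pi * k.val * x / (m * m : ℕ) + k.val * (2 * Real.pi) := by
      rw [Nat.cast_mul 2 (m * m), Int.cast_add, Int.cast_mul, Int.cast_natCast, Int.cast_natCast]
      field_simp
      push_cast
      ring
    rw [this, Real.cos_add_nat_mul_two_pi]
  refine reflection_mem_MMstarSqExp hm hg le_rfl a 1 1 (fun l h => absurd h (by omega))
    fun q r => ?_
  rw [Matrix.mul_apply]
  simp only [mul_diagonal, diagonal_mul, Pi.one_apply, one_mul, toC, Matrix.map_apply,
    transpose_apply, g]
  rw [← Finset.sum_add_distrib, Finset.mul_sum]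
  refine Finset.sum_congr rfl fun k _ => ?_
  have h1 : Real.pi * k.val * ((q.val - r.val : ℤ) : ℝ) / (m * m : ℕ) =
      angle (m * m) k.val q.val - angle (m * m) k.val r.val := by
    simp only [angle]
    push_cast at hnR ⊢
    field_simp
    ring
  have h2 : Real.pi * k.val * ((q.val + r.val + (1 : ℕ) : ℤ) : ℝ) / (m * m : ℕ) =
      angle (m * m) k.val q.val + angle (m * m) k.val r.val := by
    simp only [angle]
    push_cast at hnR ⊢
    field_simp
    ring
  have hd : ∀ k q, dct (m * m) k q = w k * Real.cos (angle (m * m) k.val q.val) := fun _ _ => rfl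
  rw [h1, h2, Real.cos_sub, Real.cos_add, hd, hd]
  simp only [Complex.ofReal_mul, Complex.ofReal_add, Complex.ofReal_sub]
  ring

end Monarch

theorem mainTheorem3 (m : ℕ) (hm : 1 ≤ m) :
    -- members of `𝓜𝓜*`
    (Monarch.convolutions (m * m) ⊆ Monarch.MMstar m ∧
      ((∃ k : ℕ, m = 2 ^ k) → Monarch.walshHadamard (m * m) ∈ Monarch.MMstar m) ∧
      Monarch.toeplitz (m * m) ⊆ Monarch.MMstarExp m (m * m) 2 ∧
      Monarch.afdf (m * m) ⊆ Monarch.MMstar m) ∧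
    -- members of `(𝓜𝓜*)²`
    (Monarch.dft (m * m) ∈ Monarch.MMstarSq m ∧
      (Monarch.toC (Monarch.dct (m * m)) ∈ Monarch.MMstarSqExp m (m * m) 2 ∧
        ∃ M ∈ Monarch.MMstarSq m, M.map Complex.re = Monarch.dct (m * m)) ∧
      (Monarch.toC (Monarch.dst (m * m)) ∈ Monarch.MMstarSqExp m (m * m) 2 ∧
        ∃ M ∈ Monarch.MMstarSq m, M.map Complex.re = Monarch.dst (m * m)) ∧
      ((∃ k : ℕ, m = 2 ^ k) → Monarch.hd3 (m * m) ⊆ Monarch.MMstarSq m) ∧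
      ((∃ k : ℕ, m = 2 ^ k) → Monarch.fastfood (m * m) ⊆ Monarch.MMstarSq m) ∧
      Monarch.acdc (m * m) ⊆ Monarch.MMstarSqExp m (m * m) 2) :=
  ⟨⟨Monarch.convolutions_subset hm, Monarch.walshHadamard_mem_MMstar,
      Monarch.toeplitz_subset hm, Monarch.afdf_subset hm⟩,
    Monarch.dft_mem_MMstarSq m,
    ⟨Monarch.dct_mem_MMstarSqExp hm, Monarch.exists_re_eq_dct m⟩,
    ⟨Monarch.dst_mem_MMstarSqExp hm, Monarch.exists_re_eq_dst m⟩,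
    Monarch.hd3_subset, Monarch.fastfood_subset,
    Set.union_subset (Monarch.diagTransform_dct_subset hm)
      (Monarch.diagTransform_dct_transpose_subset hm)⟩
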